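/- There are absolute constants $C_1,C_2,M>0$ and $\delta\in(0,1)$ such that the following holds for all positive integers $m,n$ with $m\ge Mn$ and every $x_0\in\mathbb{C}^n$. Let $a_1,\dots,a_m$ be independent random vectors of $\mathbb{C}^n$ whose coordinates are all independent with law $\mathcal N(0,\tfrac12)+i\,\mathcal N(0,\tfrac12)$ (independent real and imaginary parts). Let $A\in\mathbb{C}^{m\times n}$ be the matrix with rows $a_1^*,\dots,a_m^*$, let $A^\dagger$ be its Moore–Penrose pseudo-inverse, and let $b=|Ax_0|\in\mathbb{R}^m$ (entrywise modulus). For $z\in\mathbb{C}$ set $\mathrm{phase}(z)=z/|z|$ if $z\ne0$ and $\mathrm{phase}(0)=1$; apply $\mathrm{phase}$ entrywise to vectors, and write $\odot$ for the entrywise product. Then, with probability at least $$1-C_1\exp(-C_2m),$$ the following is true. For every eigenvector $z_0\neq 0$ associated with the largest eigenvalue of the Hermitian matrix $$\frac1m\sum_{i=1}^m |a_i^*x_0|^2\,a_ia_i^*\,\mathbf 1_{|a_i^*x_0|^2\le \frac9m\sum_{j=1}^m|a_j^*x_0|^2},$$ the sequence defined by $z_t=A^\dagger\big(b\odot\mathrm{phase}(Az_{t-1})\big)$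 for $t\ge1$ satisfies $$\forall t\ge 1,\qquad \inf_{\phi\in\mathbb{R}}\|e^{i\phi}x_0-z_t\|\le\delta^t\|x_0\|.$$ -/

import Mathlib

open MeasureTheory ProbabilityTheory Matrix
open scoped ComplexConjugate

namespace PhaseRetrieval

/-- The law of `X + Y i` with `X`, `Y` independent real normal variables of mean `0` and
variance `1/2`. -/
noncomputable def stdComplexGaussian : Measure ℂ :=
  ((gaussianReal 0 (1 / 2)).prod (gaussianReal 0 (1 / 2))).map Complex.measurableEquivRealProd.symm

/-- The sensing vectors `a₁, …, a_m` are independent standard complex Gaussian vectors of `ℂⁿ`: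
all their coordinates are independent, and each follows `N(0,1/2) + N(0,1/2) i`. -/
def IsGaussianSensing {Ω : Type*} [MeasurableSpace Ω] (P : Measure Ω) {m n : ℕ}
    (a : Fin m → Ω → EuclideanSpace ℂ (Fin n)) : Prop :=
  (∀ i j, HasLaw (fun ω => a i ω j) stdComplexGaussian P) ∧
    iIndepFun (fun (p : Fin m × Fin n) (ω : Ω) => a p.1 ω p.2) P

/-- The phase of a complex number, with the convention `phase 0 = 1`. -/
noncomputable def phase (z : ℂ) : ℂ := if z = 0 then 1 else z / (‖z‖ : ℂ)

/-- The measurement matrix, whose rows are `a₁*, …, a_m*`. -/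
noncomputable def measMatrix {m n : ℕ} (a : Fin m → EuclideanSpace ℂ (Fin n)) :
    Matrix (Fin m) (Fin n) ℂ :=
  Matrix.of fun i j => conj (a i j)

/-- The phaseless measurements `b = |A x₀|`. -/
noncomputable def measurements {m n : ℕ} (a : Fin m → EuclideanSpace ℂ (Fin n))
    (x₀ : EuclideanSpace ℂ (Fin n)) : Fin m → ℝ :=
  fun i => ‖toEuclideanLin (measMatrix a) x₀ i‖

/-- The four Penrose conditions: `B` is the Moore-Penrose pseudo-inverse of `A`. -/
structure IsMoorePenrose {m n : ℕ} (A : Matrix (Fin m) (Fin n) ℂ)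
    (B : Matrix (Fin n) (Fin m) ℂ) : Prop where
  mul_mul_left : A * B * A = A
  mul_mul_right : B * A * B = B
  herm_left : (A * B)ᴴ = A * B
  herm_right : (B * A)ᴴ = B * A

open scoped ComplexOrder in
theorem exists_isMoorePenrose {m n : ℕ} (A : Matrix (Fin m) (Fin n) ℂ) :
    ∃ B, IsMoorePenrose A B := by
  obtain ⟨H, h1, h2, h3, h4⟩ : ∃ H : Matrix (Fin n) (Fin n) ℂ,
      Aᴴ * A * H * (Aᴴ * A) = Aᴴ * A ∧ H * (Aᴴ * A) * H = H ∧ Hᴴ = H ∧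
        Aᴴ * A * H = H * (Aᴴ * A) := by
    have hG : (Aᴴ * A).IsHermitian := isHermitian_conjTranspose_mul_self A
    obtain ⟨U, d, hU, hd⟩ : ∃ (U : Matrix (Fin n) (Fin n) ℂ) (d : Fin n → ℝ),
        Uᴴ * U = 1 ∧ Aᴴ * A = U * diagonal (fun i => (d i : ℂ)) * Uᴴ := by
      refine ⟨hG.eigenvectorUnitary, hG.eigenvalues, ?_, ?_⟩
      · exact Unitary.coe_star_mul_self hG.eigenvectorUnitary
      · have := hG.spectral_theorem
        rwa [Unitary.conjStarAlgAut_apply] at this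
    have key : ∀ D E : Matrix (Fin n) (Fin n) ℂ,
        (U * D * Uᴴ) * (U * E * Uᴴ) = U * (D * E) * Uᴴ := by
      intro D E
      calc (U * D * Uᴴ) * (U * E * Uᴴ) = U * D * (Uᴴ * U) * E * Uᴴ := by
            simp only [Matrix.mul_assoc]
        _ = U * (D * E) * Uᴴ := by rw [hU]; simp only [Matrix.mul_assoc, Matrix.one_mul]
    refine ⟨U * diagonal (fun i => ((d i)⁻¹ : ℂ)) * Uᴴ, ?_, ?_, ?_, ?_⟩
    · rw [hd, key, key, diagonal_mul_diagonal, diagonal_mul_diagonal]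
      simp only [mul_inv_mul_cancel]
    · rw [hd, key, key, diagonal_mul_diagonal, diagonal_mul_diagonal]
      congr 3
      ext i
      by_cases h : (d i : ℂ) = 0 <;> simp [h]
    · rw [conjTranspose_mul, conjTranspose_mul, conjTranspose_conjTranspose,
        diagonal_conjTranspose, Matrix.mul_assoc]
      congr 3
      ext i
      simp
    · rw [hd, key, key, diagonal_mul_diagonal, diagonal_mul_diagonal]
      simp only [mul_comm]
  have h5 : A * (H * (Aᴴ * A)) = A := by
    have h6 : (A * (H * (Aᴴ * A) - 1))ᴴ * (A * (H * (Aᴴ * A) - 1)) = 0 := by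
      have h7 : Aᴴ * (A * (H * (Aᴴ * A) - 1)) = 0 := by
        rw [← Matrix.mul_assoc, Matrix.mul_sub, Matrix.mul_one, ← Matrix.mul_assoc, h1, sub_self]
      rw [conjTranspose_mul, Matrix.mul_assoc, h7, Matrix.mul_zero]
    have h8 := conjTranspose_mul_self_eq_zero.mp h6
    rwa [Matrix.mul_sub, Matrix.mul_one, sub_eq_zero] at h8
  refine ⟨H * Aᴴ, ?_, ?_, ?_, ?_⟩
  · simpa only [Matrix.mul_assoc] using h5
  · calc H * Aᴴ * A * (H * Aᴴ) = H * (Aᴴ * A) * H * Aᴴ := by simp only [Matrix.mul_assoc]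
      _ = H * Aᴴ := by rw [h2]
  · simp only [conjTranspose_mul, conjTranspose_conjTranspose, h3, Matrix.mul_assoc]
  · rw [Matrix.mul_assoc, conjTranspose_mul, h3, conjTranspose_mul, conjTranspose_conjTranspose, h4]

theorem IsMoorePenrose.unique {m n : ℕ} {A : Matrix (Fin m) (Fin n) ℂ}
    {B C : Matrix (Fin n) (Fin m) ℂ} (hB : IsMoorePenrose A B) (hC : IsMoorePenrose A C) :
    B = C := by
  have e1 : A * B = A * C := by
    calc A * B = (A * B)ᴴ := hB.herm_left.symm
      _ = (A * C * A * B)ᴴ := by rw [hC.mul_mul_left]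
      _ = (A * B)ᴴ * (A * C)ᴴ := by rw [← conjTranspose_mul]; simp only [Matrix.mul_assoc]
      _ = A * B * A * C := by rw [hB.herm_left, hC.herm_left]; simp only [Matrix.mul_assoc]
      _ = A * C := by rw [hB.mul_mul_left]
  have e2 : B * A = C * A := by
    calc B * A = (B * A)ᴴ := hB.herm_right.symm
      _ = (B * (A * C * A))ᴴ := by rw [hC.mul_mul_left]
      _ = (C * A)ᴴ * (B * A)ᴴ := by rw [← conjTranspose_mul]; simp only [Matrix.mul_assoc]
      _ = C * (A * B * A) := by rw [hB.herm_right, hC.herm_right]; simp only [Matrix.mul_assoc]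
      _ = C * A := by rw [hB.mul_mul_left]
  calc B = B * A * B := hB.mul_mul_right.symm
    _ = C * A * C := by rw [e2, Matrix.mul_assoc, e1, ← Matrix.mul_assoc]
    _ = C := hC.mul_mul_right

/-- The Moore-Penrose pseudo-inverse `A†`. -/
noncomputable def pinv {m n : ℕ} (A : Matrix (Fin m) (Fin n) ℂ) : Matrix (Fin n) (Fin m) ℂ :=
  (exists_isMoorePenrose A).choose

theorem pinv_spec {m n : ℕ} (A : Matrix (Fin m) (Fin n) ℂ) : IsMoorePenrose A (pinv A) :=
  (exists_isMoorePenrose A).choose_spec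

/-- The matrix of the truncated spectral initialization,
`(1/m) ∑ᵢ bᵢ² aᵢ aᵢ* 1_{bᵢ² ≤ (9/m) ∑ⱼ bⱼ²}`. -/
noncomputable def initMatrix {m n : ℕ} (a : Fin m → EuclideanSpace ℂ (Fin n)) (b : Fin m → ℝ) :
    Matrix (Fin n) (Fin n) ℂ :=
  (1 / (m : ℂ)) • ∑ i, (if b i ^ 2 ≤ 9 / (m : ℝ) * ∑ j, b j ^ 2 then ((b i : ℂ) ^ 2) else 0) •
    vecMulVec (fun k => a i k) (fun k => conj (a i k))

/-- `z` is a main eigenvector of the (Hermitian) matrix `Y`: a nonzero eigenvector for its largest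
eigenvalue. -/
def IsMainEigenvector {n : ℕ} (Y : Matrix (Fin n) (Fin n) ℂ) (z : EuclideanSpace ℂ (Fin n)) :
    Prop :=
  ∃ μ : ℝ, Module.End.HasEigenvector (toEuclideanLin Y) (μ : ℂ) z ∧
    ∀ ν : ℝ, Module.End.HasEigenvalue (toEuclideanLin Y) (ν : ℂ) → ν ≤ μ

/-- One step of alternating projections, `z ↦ A† (b ⊙ phase (A z))`. -/
noncomputable def altProjStep {m n : ℕ} (A : Matrix (Fin m) (Fin n) ℂ) (b : Fin m → ℝ)
    (z : EuclideanSpace ℂ (Fin n)) : EuclideanSpace ℂ (Fin n) :=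
  toEuclideanLin (pinv A) (WithLp.toLp 2 fun i => (b i : ℂ) * phase (toEuclideanLin A z i))

/-- `z₀, z₁, z₂, …` are the iterates of alternating projections with truncated spectral
initialization, for the sensing vectors `a` and the measurements `b`. -/
structure IsAltProjRun {m n : ℕ} (a : Fin m → EuclideanSpace ℂ (Fin n)) (b : Fin m → ℝ)
    (z : ℕ → EuclideanSpace ℂ (Fin n)) : Prop where
  init : IsMainEigenvector (initMatrix a b) (z 0)
  step : ∀ t, z (t + 1) = altProjStep (measMatrix a) b (z t)

end PhaseRetrieval

namespace PhaseRetrieval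

/-! One step of alternating projections contracts towards the signal as soon as the iterate is
nearly collinear to it, and the spectral initialization is nearly collinear to it. Both facts follow
deterministically from the properties collected in `GoodSensing`, which Gaussian vectors satisfy
outside an exponentially small event. Everything is homogeneous in the signal, so a unit vector `x`
suffices; the zero signal is trivial.

Contraction (`GoodSensing.norm_sub_altProjStep_le`): write the iterate as `α • x + v` with `v`
orthogonal to `x`, and put `g = A x`, `h = A (v / α)`. As `A A†` is an orthogonal projection and `A`
is bounded below by `19/20 * √m`, the new error is controlled by the distance from `phase α * g` to
`|g| * phase (α * (g + h))`. Where `|h| ≤ |g| / 10`, the phase reacts to first order only to the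
component of `h` in quadrature with `g`, that is to `Im (conj (phase g) * h)`. Since `h` is
independent of `g`, this component carries about half of the energy of `h`: a factor close to
`√(1/2)`, whence the gain. The remaining coordinates form a small proportion, because few entries of
`g` are tiny and few entries of `h` are large, and no small set of coordinates can carry much of the
energy of any `A v`.

Initialization (`GoodSensing.exists_decomposition_of_isMainEigenvector`): the quadratic form of the
truncated matrix is at least `3/2` at `x` (fourth moment `2`, less the truncation), at most `6/5` on
unit vectors orthogonal to `x`, and almost without cross terms. This spectral gap forces a top
eigenvector to be close to the line of `x`.

Probability (`IsGaussianSensing.measure_not_goodSensing_le`): measurements along orthonormal vectors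
are independent Gaussian vectors. Each property at a fixed `v` is thus a Chernoff bound,
conditionally on `A x` where needed. A union bound over a net of size exponential in `n` costs
nothing when `m ≥ M * n`, and Lipschitz estimates extend the properties from the net to all vectors
(`GoodSensing.of_net`). -/

/-! ### The standard complex Gaussian law: characteristic function, exponential and polynomial
moments. -/

instance : IsProbabilityMeasure stdComplexGaussian :=
  Measure.isProbabilityMeasure_map (by fun_prop)

theorem charFunDual_gaussianReal_zero (v : NNReal) (L : StrongDual ℝ ℝ) :
    charFunDual (gaussianReal 0 v) L = Complex.exp (-(v * (L 1) ^ 2 / 2 : ℝ)) := by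
  have h : ∀ x : ℝ, L x = L 1 * x := fun x => by
    have := L.map_smul x 1
    rw [smul_eq_mul, mul_one] at this
    rw [this, smul_eq_mul, mul_comm]
  have h2 := charFun_gaussianReal (μ := 0) (v := v) (L 1)
  rw [charFun_apply_real] at h2
  have h3 : (fun x : ℝ => Complex.exp (L x * Complex.I))
      = fun x : ℝ => Complex.exp ((L 1 : ℝ) * (x : ℝ) * Complex.I) := by
    funext x
    rw [h x, Complex.ofReal_mul]
  rw [charFunDual_apply, h3, h2]
  congr 1
  push_cast
  ring

/-- Through this formula, rotation invariance and independence along orthonormal directions both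
become identities between quadratic forms. -/
theorem charFunDual_stdComplexGaussian (L : StrongDual ℝ ℂ) :
    charFunDual stdComplexGaussian L
      = Complex.exp (-(((L 1) ^ 2 + (L Complex.I) ^ 2) / 4 : ℝ)) := by
  have h : stdComplexGaussian = ((gaussianReal 0 (1 / 2)).prod (gaussianReal 0 (1 / 2))).map
      (Complex.equivRealProdCLM.symm : ℝ × ℝ →L[ℝ] ℂ) := rfl
  rw [h, charFunDual_map, charFunDual_prod, charFunDual_gaussianReal_zero,
    charFunDual_gaussianReal_zero, ← Complex.exp_add]
  have e1 : (Complex.equivRealProdCLM.symm (1, 0) : ℂ) = 1 := by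
    apply Complex.ext <;> simp
  have e2 : (Complex.equivRealProdCLM.symm (0, 1) : ℂ) = Complex.I := by
    apply Complex.ext <;> simp
  simp only [ContinuousLinearMap.comp_apply, ContinuousLinearMap.inl_apply,
    ContinuousLinearMap.inr_apply, ContinuousLinearEquiv.coe_coe, e1, e2]
  congr 1
  push_cast
  ring

theorem strongDual_complex_apply (L : StrongDual ℝ ℂ) (z : ℂ) :
    L z = z.re * L 1 + z.im * L Complex.I := by
  have hz : z = z.re • (1 : ℂ) + z.im • Complex.I := by
    apply Complex.ext <;> simp
  conv_lhs => rw [hz, map_add, L.map_smul, L.map_smul, smul_eq_mul, smul_eq_mul]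

/-- The standard complex Gaussian law is invariant under rotations. -/
theorem stdComplexGaussian_map_mul {u : ℂ} (hu : ‖u‖ = 1) :
    stdComplexGaussian.map (fun z => u * z) = stdComplexGaussian := by
  have h : (fun z : ℂ => u * z) = (ContinuousLinearMap.mul ℝ ℂ u : ℂ →L[ℝ] ℂ) := rfl
  have hm : IsProbabilityMeasure (stdComplexGaussian.map (fun z => u * z)) :=
    Measure.isProbabilityMeasure_map (by fun_prop)
  apply Measure.ext_of_charFunDual
  ext L
  rw [h, charFunDual_map, charFunDual_stdComplexGaussian, charFunDual_stdComplexGaussian]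
  congr 3
  have hu' : u.re * u.re + u.im * u.im = 1 := by
    rw [← Complex.normSq_apply, Complex.normSq_eq_norm_sq, hu, one_pow]
  simp only [ContinuousLinearMap.comp_apply, ContinuousLinearMap.mul_apply', mul_one]
  rw [strongDual_complex_apply L u, strongDual_complex_apply L (u * Complex.I)]
  simp only [Complex.mul_re, Complex.mul_im, Complex.I_re, Complex.I_im]
  congr 1
  linear_combination (L 1 ^ 2 + L Complex.I ^ 2) * hu'

theorem stdComplexGaussian_eq_withDensity :
    stdComplexGaussian =
      volume.withDensity (fun z : ℂ => ENNReal.ofReal (Real.pi⁻¹ * Real.exp (-‖z‖ ^ 2))) := by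
  have hv : ((1 : NNReal) / 2) ≠ 0 := by simp
  rw [stdComplexGaussian, gaussianReal_of_var_ne_zero _ hv,
    prod_withDensity (by fun_prop) (by fun_prop)]
  ext s hs
  rw [MeasurableEquiv.map_apply, withDensity_apply _ (MeasurableEquiv.measurable _ hs),
    withDensity_apply _ hs, ← Measure.volume_eq_prod,
    ← Complex.volume_preserving_equiv_real_prod.symm.setLIntegral_comp_preimage hs
      (by fun_prop)]
  refine lintegral_congr fun p => ?_
  rw [gaussianPDF, gaussianPDF, ← ENNReal.ofReal_mul (gaussianPDFReal_nonneg _ _ _),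
    gaussianPDFReal, gaussianPDFReal]
  congr 1
  have h1 : ‖Complex.measurableEquivRealProd.symm p‖ ^ 2 = p.1 ^ 2 + p.2 ^ 2 := by
    rw [← Complex.normSq_eq_norm_sq, Complex.normSq_apply]
    simp only [Complex.measurableEquivRealProd_symm_apply]
    ring
  have h2 : (2 * Real.pi * ((1 / 2 : NNReal) : ℝ)) = Real.pi := by push_cast; ring
  have h3 : (2 * ((1 / 2 : NNReal) : ℝ)) = 1 := by push_cast; ring
  rw [h1, h2, h3]
  simp only [sub_zero, div_one]
  rw [mul_mul_mul_comm, ← mul_inv, Real.mul_self_sqrt Real.pi_pos.le, ← Real.exp_add]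
  congr 2
  ring

/-- The squared modulus is an exponential variable of rate one. -/
theorem lintegral_exp_mul_norm_sq {l : ℝ} (hl : l < 1) :
    ∫⁻ z, ENNReal.ofReal (Real.exp (l * ‖z‖ ^ 2)) ∂stdComplexGaussian
      = ENNReal.ofReal (1 / (1 - l)) := by
  have hb : 0 < 1 - l := by linarith
  have key := Complex.integral_exp_neg_mul_rpow (p := 2) (b := 1 - l) (by norm_num) hb
  have h1 : (-2 / 2 : ℝ) = -1 := by norm_num
  have h2 : (2 / 2 + 1 : ℝ) = 2 := by norm_num
  rw [h1, h2, Real.Gamma_two, Real.rpow_neg_one, mul_one] at key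
  -- A non-integrable function would have Bochner integral zero, against the positive value in
  -- `key`.
  have hint : Integrable (fun x : ℂ => Real.exp (-(1 - l) * ‖x‖ ^ (2 : ℝ))) := by
    by_contra h
    rw [integral_undef h] at key
    have := Real.pi_pos
    have : 0 < Real.pi * (1 - l)⁻¹ := by positivity
    linarith
  rw [stdComplexGaussian_eq_withDensity,
    lintegral_withDensity_eq_lintegral_mul _ (by fun_prop) (by fun_prop)]
  have h3 : ∀ z : ℂ, ((fun z : ℂ => ENNReal.ofReal (Real.pi⁻¹ * Real.exp (-‖z‖ ^ 2))) *
      fun z : ℂ => ENNReal.ofReal (Real.exp (l * ‖z‖ ^ 2))) z =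
      ENNReal.ofReal (Real.pi⁻¹ * Real.exp (-(1 - l) * ‖z‖ ^ (2 : ℝ))) := fun z => by
    rw [Pi.mul_apply, ← ENNReal.ofReal_mul (by positivity), mul_assoc, ← Real.exp_add,
      Real.rpow_two]
    congr 3
    ring
  rw [lintegral_congr h3, ← ofReal_integral_eq_lintegral_ofReal (hint.const_mul _)
    (Filter.Eventually.of_forall fun z => by positivity), integral_const_mul, key]
  congr 1
  field_simp

theorem one_div_one_sub_le_exp {l : ℝ} (hl : l < 1) : 1 / (1 - l) ≤ Real.exp (l / (1 - l)) := by
  have hb : 0 < 1 - l := by linarith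
  have h : 1 / (1 - l) = l / (1 - l) + 1 := by field_simp; ring
  rw [h]
  exact Real.add_one_le_exp _

/-- An upper bound for the exponential moments of the squared modulus. -/
theorem lintegral_exp_mul_norm_sq_le {l : ℝ} (hl : l ≤ 1 / 2) :
    ∫⁻ z, ENNReal.ofReal (Real.exp (l * ‖z‖ ^ 2)) ∂stdComplexGaussian
      ≤ ENNReal.ofReal (Real.exp (l + 2 * l ^ 2)) := by
  rw [lintegral_exp_mul_norm_sq (by linarith)]
  refine ENNReal.ofReal_le_ofReal ((one_div_one_sub_le_exp (by linarith)).trans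
    (Real.exp_le_exp.2 ?_))
  rw [div_le_iff₀ (by linarith)]
  nlinarith [sq_nonneg l, mul_nonneg (sq_nonneg l) (sub_nonneg.2 hl)]

theorem lintegral_stdComplexGaussian_mul {f g : ℝ → ENNReal} (hf : Measurable f)
    (hg : Measurable g) :
    ∫⁻ z : ℂ, f z.re * g z.im ∂stdComplexGaussian
      = (∫⁻ x, f x ∂gaussianReal 0 (1 / 2)) * ∫⁻ x, g x ∂gaussianReal 0 (1 / 2) := by
  rw [stdComplexGaussian, lintegral_map (by fun_prop) (by fun_prop)]
  exact lintegral_prod_mul hf.aemeasurable hg.aemeasurable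

/-- Real and imaginary parts are independent with the same law, so the transform of the squared
modulus is the square of the one sought; take a square root of the previous bound. -/
theorem lintegral_exp_mul_im_sq_le {l : ℝ} (hl : l ≤ 1 / 2) :
    ∫⁻ z : ℂ, ENNReal.ofReal (Real.exp (l * z.im ^ 2)) ∂stdComplexGaussian
      ≤ ENNReal.ofReal (Real.exp (l / 2 + l ^ 2)) := by
  set J := ∫⁻ x, ENNReal.ofReal (Real.exp (l * x ^ 2)) ∂gaussianReal 0 (1 / 2) with hJ
  have h1 : ∫⁻ z : ℂ, ENNReal.ofReal (Real.exp (l * z.im ^ 2)) ∂stdComplexGaussian = J := by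
    have := lintegral_stdComplexGaussian_mul (f := fun _ => 1)
      (g := fun x => ENNReal.ofReal (Real.exp (l * x ^ 2))) (by fun_prop) (by fun_prop)
    simpa only [one_mul, lintegral_one, measure_univ] using this
  have h2 : ∫⁻ z : ℂ, ENNReal.ofReal (Real.exp (l * ‖z‖ ^ 2)) ∂stdComplexGaussian = J ^ 2 := by
    rw [sq, hJ, ← lintegral_stdComplexGaussian_mul (by fun_prop) (by fun_prop)]
    refine lintegral_congr fun z => ?_
    rw [← ENNReal.ofReal_mul (by positivity), ← Real.exp_add, ← Complex.normSq_eq_norm_sq,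
      Complex.normSq_apply]
    congr 2
    ring
  have h3 := lintegral_exp_mul_norm_sq_le hl
  rw [h2] at h3
  rw [h1]
  refine (ENNReal.pow_le_pow_left_iff (two_ne_zero)).1 (h3.trans (le_of_eq ?_))
  rw [← ENNReal.ofReal_pow (by positivity), ← Real.exp_nat_mul]
  congr 2
  push_cast
  ring

theorem lintegral_exp_re_mul (c : ℂ) :
    ∫⁻ z : ℂ, ENNReal.ofReal (Real.exp (c * z).re) ∂stdComplexGaussian
      = ENNReal.ofReal (Real.exp (‖c‖ ^ 2 / 4)) := by
  have hmgf : ∀ t : ℝ, ∫⁻ x, ENNReal.ofReal (Real.exp (t * x)) ∂gaussianReal 0 (1 / 2)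
      = ENNReal.ofReal (Real.exp (t ^ 2 / 4)) := fun t => by
    rw [← ofReal_integral_eq_lintegral_ofReal (integrable_exp_mul_gaussianReal t)
      (Filter.Eventually.of_forall fun z => by positivity)]
    have := congrFun (mgf_id_gaussianReal (μ := 0) (v := 1 / 2)) t
    simp only [mgf, id] at this
    rw [this]
    congr 2
    push_cast
    ring
  have h : ∀ z : ℂ, ENNReal.ofReal (Real.exp (c * z).re)
      = ENNReal.ofReal (Real.exp (c.re * z.re)) * ENNReal.ofReal (Real.exp (-c.im * z.im)) :=
    fun z => by
      rw [← ENNReal.ofReal_mul (by positivity), ← Real.exp_add, Complex.mul_re]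
      congr 2
      ring
  rw [lintegral_congr h, lintegral_stdComplexGaussian_mul
    (f := fun x => ENNReal.ofReal (Real.exp (c.re * x)))
    (g := fun x => ENNReal.ofReal (Real.exp (-c.im * x))) (by fun_prop) (by fun_prop), hmgf, hmgf,
    ← ENNReal.ofReal_mul (by positivity), ← Real.exp_add, ← Complex.normSq_eq_norm_sq,
    Complex.normSq_apply]
  congr 2
  ring

theorem integral_norm_pow (k : ℕ) :
    ∫ z, ‖z‖ ^ (2 * k) ∂stdComplexGaussian = k.factorial := by
  have key := Complex.integral_rpow_mul_exp_neg_rpow (p := 2) (q := 2 * k) (by norm_num)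
    (by have : (0 : ℝ) ≤ k := by positivity
        linarith)
  have h1 : ((2 * k + 2) / 2 : ℝ) = k + 1 := by ring
  rw [h1, Real.Gamma_nat_eq_factorial] at key
  rw [stdComplexGaussian_eq_withDensity,
    integral_withDensity_eq_integral_toReal_smul (by fun_prop)
      (Filter.Eventually.of_forall fun z => ENNReal.ofReal_lt_top)]
  have h3 : ∀ z : ℂ, (ENNReal.ofReal (Real.pi⁻¹ * Real.exp (-‖z‖ ^ 2))).toReal • ‖z‖ ^ (2 * k)
      = Real.pi⁻¹ * (‖z‖ ^ (2 * k : ℝ) * Real.exp (-‖z‖ ^ (2 : ℝ))) := fun z => by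
    rw [ENNReal.toReal_ofReal (by positivity), smul_eq_mul, Real.rpow_two]
    have : (2 * k : ℝ) = ((2 * k : ℕ) : ℝ) := by push_cast; ring
    rw [this, Real.rpow_natCast]
    ring
  simp_rw [h3]
  rw [integral_const_mul, key]
  have := Real.pi_ne_zero
  field_simp

theorem integrable_norm_pow (k : ℕ) :
    Integrable (fun z : ℂ => ‖z‖ ^ (2 * k)) stdComplexGaussian := by
  by_contra h
  have := integral_norm_pow k
  rw [integral_undef h] at this
  exact (Nat.factorial_ne_zero k) (by exact_mod_cast this.symm)

/-! ### Joint law of the measurements along an orthonormal family. -/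

theorem measMatrix_apply {m n : ℕ} (a : Fin m → EuclideanSpace ℂ (Fin n))
    (v : EuclideanSpace ℂ (Fin n)) (i : Fin m) :
    toEuclideanLin (measMatrix a) v i = ∑ j, conj (a i j) * v j := by
  simp [toLpLin_apply, measMatrix, mulVec, dotProduct]

theorem IsGaussianSensing.hasLaw_entries {Ω : Type*} [MeasurableSpace Ω] {P : Measure Ω}
    [IsProbabilityMeasure P] {m n : ℕ} {a : Fin m → Ω → EuclideanSpace ℂ (Fin n)}
    (ha : IsGaussianSensing P a) :
    HasLaw (fun ω (p : Fin m × Fin n) => a p.1 ω p.2)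
      (Measure.pi fun _ => stdComplexGaussian) P where
  aemeasurable := aemeasurable_pi_lambda _ fun p => (ha.1 p.1 p.2).aemeasurable
  map_eq := by
    rw [(iIndepFun_iff_map_fun_eq_pi_map fun p : Fin m × Fin n =>
      (ha.1 p.1 p.2).aemeasurable).1 ha.2]
    congr 1
    funext p
    exact (ha.1 p.1 p.2).map_eq

/-- The measurements along the vectors `w k`, as a linear map of the entries. -/
noncomputable def entriesToMeas {m n : ℕ} {κ : Type*} [Fintype κ]
    (w : κ → EuclideanSpace ℂ (Fin n)) :
    (Fin m × Fin n → ℂ) →L[ℝ] (κ → Fin m → ℂ) :=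
  ContinuousLinearMap.pi fun k => ContinuousLinearMap.pi fun i =>
    ∑ j, (ContinuousLinearMap.mul ℝ ℂ (w k j)).comp
      ((Complex.conjCLE : ℂ →L[ℝ] ℂ).comp
        (ContinuousLinearMap.proj (R := ℝ) (φ := fun _ : Fin m × Fin n => ℂ) (i, j)))

theorem entriesToMeas_apply {m n : ℕ} {κ : Type*} [Fintype κ]
    (w : κ → EuclideanSpace ℂ (Fin n)) (x : Fin m × Fin n → ℂ) (k : κ) (i : Fin m) :
    entriesToMeas w x k i = ∑ j, w k j * conj (x (i, j)) := by
  simp [entriesToMeas]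

theorem sum_norm_sq_of_orthonormal {n : ℕ} {κ : Type*} [Fintype κ]
    {w : κ → EuclideanSpace ℂ (Fin n)} (hw : Orthonormal ℂ w) (c : κ → ℂ) :
    ∑ j, ‖∑ k, c k * w k j‖ ^ 2 = ∑ k, ‖c k‖ ^ 2 := by
  have h := hw.inner_sum c c Finset.univ
  have h2 : inner ℂ (∑ k, c k • w k) (∑ k, c k • w k) = ((‖∑ k, c k • w k‖ ^ 2 : ℝ) : ℂ) := by
    rw [inner_self_eq_norm_sq_to_K]; norm_cast
  rw [h2, EuclideanSpace.norm_sq_eq] at h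
  have h3 : ∑ k, conj (c k) * c k = ((∑ k, ‖c k‖ ^ 2 : ℝ) : ℂ) := by
    push_cast
    exact Finset.sum_congr rfl fun k _ => by rw [Complex.conj_mul']
  rw [h3, Complex.ofReal_inj] at h
  rw [← h]
  refine Finset.sum_congr rfl fun j _ => ?_
  simp

/-- Both characteristic functions are exponentials of quadratic forms, which agree by Pythagoras for
the orthonormal family `w`. -/
theorem map_entriesToMeas {m n : ℕ} {κ : Type*} [Fintype κ]
    {w : κ → EuclideanSpace ℂ (Fin n)} (hw : Orthonormal ℂ w) :
    (Measure.pi fun _ : Fin m × Fin n => stdComplexGaussian).map (entriesToMeas w)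
      = Measure.pi fun _ : κ => Measure.pi fun _ : Fin m => stdComplexGaussian := by
  classical
  have : IsProbabilityMeasure
      ((Measure.pi fun _ : Fin m × Fin n => stdComplexGaussian).map (entriesToMeas w)) :=
    Measure.isProbabilityMeasure_map (by fun_prop)
  apply Measure.ext_of_charFunDual
  ext L
  rw [charFunDual_map, charFunDual_pi, charFunDual_pi]
  simp_rw [charFunDual_pi, charFunDual_stdComplexGaussian, ← Complex.exp_sum]
  congr 1
  simp_rw [← Complex.ofReal_neg, ← Complex.ofReal_sum]
  congr 1
  set ℓ : κ → Fin m → StrongDual ℝ ℂ := fun k i =>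
    (L.comp (.single ℝ (fun _ : κ => Fin m → ℂ) k)).comp (.single ℝ (fun _ : Fin m => ℂ) i)
    with hℓ
  -- The complex number representing the real functional `ℓ k i` as `z ↦ Re (c i k * z)`.
  set c : Fin m → κ → ℂ := fun i k => ⟨ℓ k i 1, -ℓ k i Complex.I⟩ with hc
  have hℓc : ∀ k i z, ℓ k i z = (c i k * z).re := fun k i z => by
    rw [strongDual_complex_apply (ℓ k i) z, Complex.mul_re, hc]
    ring
  have hsplit : ∀ (p : Fin m × Fin n) (z : ℂ), ((L.comp (entriesToMeas w)).comp
      (.single ℝ (fun _ : Fin m × Fin n => ℂ) p)) z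
      = ((∑ k, c p.1 k * w k p.2) * conj z).re := fun p z => by
    have e : entriesToMeas w (Pi.single p z)
        = ∑ k, (Pi.single k (Pi.single p.1 (w k p.2 * conj z)) : κ → Fin m → ℂ) := by
      funext k i
      rw [entriesToMeas_apply, Finset.sum_apply, Finset.sum_apply,
        Finset.sum_eq_single k (fun k' _ h => by rw [Pi.single_eq_of_ne h.symm]; rfl) (by simp),
        Pi.single_eq_same, Finset.sum_eq_single p.2]
      · by_cases hi : i = p.1
        · subst hi; simp
        · rw [Pi.single_eq_of_ne hi, Pi.single_eq_of_ne (by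
            rintro h; exact hi (by rw [← h]))]
          simp
      · intro j _ hj
        rw [Pi.single_eq_of_ne (by rintro h; exact hj (by rw [← h]))]
        simp
      · simp
    simp only [ContinuousLinearMap.comp_apply, ContinuousLinearMap.single_apply, e, map_sum]
    rw [Finset.sum_mul, Complex.re_sum]
    refine Finset.sum_congr rfl fun k _ => ?_
    rw [mul_assoc, ← hℓc]
    simp [hℓ]
  have hq : ∀ k i, (ℓ k i 1) ^ 2 + (ℓ k i Complex.I) ^ 2 = ‖c i k‖ ^ 2 := fun k i => by
    rw [← Complex.normSq_eq_norm_sq, Complex.normSq_apply, hc]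
    ring
  calc _ = ∑ p : Fin m × Fin n, -(‖∑ k, c p.1 k * w k p.2‖ ^ 2 / 4) := by
        refine Finset.sum_congr rfl fun p _ => ?_
        rw [hsplit, hsplit, ← Complex.normSq_eq_norm_sq, Complex.normSq_apply]
        simp
        ring
    _ = ∑ i, ∑ k, -(‖c i k‖ ^ 2 / 4) := by
        rw [Fintype.sum_prod_type]
        refine Finset.sum_congr rfl fun i _ => ?_
        simp only [Finset.sum_neg_distrib, ← Finset.sum_div]
        rw [sum_norm_sq_of_orthonormal hw]
    _ = ∑ k, ∑ i, -(‖c i k‖ ^ 2 / 4) := Finset.sum_comm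
    _ = _ := Finset.sum_congr rfl fun k _ => Finset.sum_congr rfl fun i _ => by
        rw [← hq]

section Laws

variable {Ω : Type*} [MeasurableSpace Ω] {P : Measure Ω} [IsProbabilityMeasure P] {m n : ℕ}
  {a : Fin m → Ω → EuclideanSpace ℂ (Fin n)}

theorem IsGaussianSensing.hasLaw_family (ha : IsGaussianSensing P a) {κ : Type*} [Fintype κ]
    {w : κ → EuclideanSpace ℂ (Fin n)} (hw : Orthonormal ℂ w) :
    HasLaw (fun ω k i => toEuclideanLin (measMatrix fun i => a i ω) (w k) i)
      (Measure.pi fun _ : κ => Measure.pi fun _ : Fin m => stdComplexGaussian) P := by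
  have h1 : HasLaw (entriesToMeas w)
      (Measure.pi fun _ : κ => Measure.pi fun _ : Fin m => stdComplexGaussian)
      (Measure.pi fun _ : Fin m × Fin n => stdComplexGaussian) :=
    ⟨by fun_prop, map_entriesToMeas hw⟩
  have h2 := h1.comp ha.hasLaw_entries
  refine h2.congr (Filter.Eventually.of_forall fun ω => ?_)
  funext k i
  simp only [measMatrix_apply, Function.comp, entriesToMeas_apply]
  exact Finset.sum_congr rfl fun j _ => mul_comm _ _

/-- Measurements along a unit vector are independent standard complex Gaussian variables. -/
theorem IsGaussianSensing.hasLaw_single (ha : IsGaussianSensing P a)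
    {v : EuclideanSpace ℂ (Fin n)} (hv : ‖v‖ = 1) :
    HasLaw (fun ω i => toEuclideanLin (measMatrix fun i => a i ω) v i)
      (Measure.pi fun _ : Fin m => stdComplexGaussian) P := by
  have hw : Orthonormal ℂ (fun _ : Unit => v) := ⟨fun _ => hv, fun i j h => (h rfl).elim⟩
  have h := measurePreserving_eval
    (fun _ : Unit => Measure.pi fun _ : Fin m => stdComplexGaussian) ()
  exact (HasLaw.mk h.aemeasurable h.map_eq).comp (ha.hasLaw_family hw)

/-- Measurements along two orthonormal vectors are independent of each other. -/
theorem IsGaussianSensing.hasLaw_pair (ha : IsGaussianSensing P a)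
    {x v : EuclideanSpace ℂ (Fin n)} (hx : ‖x‖ = 1) (hv : ‖v‖ = 1) (hxv : inner ℂ x v = 0) :
    HasLaw (fun ω => ((fun i => toEuclideanLin (measMatrix fun i => a i ω) x i),
        (fun i => toEuclideanLin (measMatrix fun i => a i ω) v i)))
      ((Measure.pi fun _ : Fin m => stdComplexGaussian).prod
        (Measure.pi fun _ : Fin m => stdComplexGaussian)) P := by
  have hw : Orthonormal ℂ ![x, v] := by
    rw [orthonormal_vecCons_iff]
    refine ⟨hx, ?_, ?_⟩
    · simpa using hxv
    · exact ⟨by simpa using hv, fun i j h => (h (Subsingleton.elim _ _)).elim⟩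
  have h := measurePreserving_finTwoArrow (Measure.pi fun _ : Fin m => stdComplexGaussian)
  exact (HasLaw.mk h.aemeasurable h.map_eq).comp (ha.hasLaw_family hw)

end Laws

/-! ### Chernoff bounds for Gaussian vectors. -/

/-- The law of `m` independent standard complex Gaussian variables. -/
noncomputable abbrev gaussianVec (m : ℕ) : Measure (Fin m → ℂ) :=
  Measure.pi fun _ => stdComplexGaussian

theorem lintegral_exp_sum_le {m : ℕ} {F : Fin m → ℂ → ℝ} (hF : ∀ i, Measurable (F i))
    {κ : Fin m → ℝ}
    (h : ∀ i, ∫⁻ z, ENNReal.ofReal (Real.exp (F i z)) ∂stdComplexGaussian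
      ≤ ENNReal.ofReal (Real.exp (κ i))) :
    ∫⁻ x, ENNReal.ofReal (Real.exp (∑ i, F i (x i))) ∂gaussianVec m
      ≤ ENNReal.ofReal (Real.exp (∑ i, κ i)) := by
  have hm : ∀ i, Measurable fun z => ENNReal.ofReal (Real.exp (F i z)) := fun i =>
    ENNReal.measurable_ofReal.comp (Real.measurable_exp.comp (hF i))
  have hind : iIndepFun (fun i (x : Fin m → ℂ) => ENNReal.ofReal (Real.exp (F i (x i))))
      (gaussianVec m) :=
    iIndepFun_pi (X := fun i z => ENNReal.ofReal (Real.exp (F i z))) fun i => (hm i).aemeasurable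
  have h1 := lintegral_prod_eq_prod_lintegral_of_indepFun Finset.univ _ hind
    (fun i => (hm i).comp (measurable_pi_apply i))
  calc _ = ∫⁻ x, ∏ i, ENNReal.ofReal (Real.exp (F i (x i))) ∂gaussianVec m := by
        refine lintegral_congr fun x => ?_
        rw [Real.exp_sum, ENNReal.ofReal_prod_of_nonneg fun i _ => (Real.exp_pos _).le]
    _ = ∏ i, ∫⁻ x, ENNReal.ofReal (Real.exp (F i (x i))) ∂gaussianVec m := h1
    _ ≤ ∏ i, ENNReal.ofReal (Real.exp (κ i)) := by
        refine Finset.prod_le_prod' fun i _ => ?_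
        rw [(measurePreserving_eval (fun _ : Fin m => stdComplexGaussian) i).lintegral_comp (hm i)]
        exact h i
    _ = _ := by
        rw [Real.exp_sum, ENNReal.ofReal_prod_of_nonneg fun i _ => (Real.exp_pos _).le]

/-- The Chernoff bound for independent functions of standard complex Gaussian variables. -/
theorem gaussianVec_chernoff {m : ℕ} {F : Fin m → ℂ → ℝ} (hF : ∀ i, Measurable (F i))
    {κ : Fin m → ℝ}
    (h : ∀ i, ∫⁻ z, ENNReal.ofReal (Real.exp (F i z)) ∂stdComplexGaussian
      ≤ ENNReal.ofReal (Real.exp (κ i))) {s r : ℝ} (hr : ∑ i, κ i - s ≤ r) :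
    gaussianVec m {x | s ≤ ∑ i, F i (x i)} ≤ ENNReal.ofReal (Real.exp r) := by
  have hmeas : Measurable fun x : Fin m → ℂ => ENNReal.ofReal (Real.exp (∑ i, F i (x i))) :=
    ENNReal.measurable_ofReal.comp (Real.measurable_exp.comp
      (Finset.measurable_sum _ fun i _ => (hF i).comp (measurable_pi_apply i)))
  have h1 := mul_meas_ge_le_lintegral (μ := gaussianVec m) hmeas (ENNReal.ofReal (Real.exp s))
  have h2 : {x : Fin m → ℂ | s ≤ ∑ i, F i (x i)} = {x | ENNReal.ofReal (Real.exp s)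
      ≤ ENNReal.ofReal (Real.exp (∑ i, F i (x i)))} := by
    ext x
    simp only [Set.mem_ofPred_eq]
    rw [ENNReal.ofReal_le_ofReal_iff (Real.exp_pos _).le, Real.exp_le_exp]
  rw [← h2] at h1
  have h3 := h1.trans (lintegral_exp_sum_le hF h)
  have h4 : gaussianVec m {x | s ≤ ∑ i, F i (x i)}
      = ENNReal.ofReal (Real.exp (-s)) * (ENNReal.ofReal (Real.exp s)
        * gaussianVec m {x | s ≤ ∑ i, F i (x i)}) := by
    rw [← mul_assoc, ← ENNReal.ofReal_mul (Real.exp_pos _).le, ← Real.exp_add]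
    simp
  rw [h4]
  calc _ ≤ ENNReal.ofReal (Real.exp (-s)) * ENNReal.ofReal (Real.exp (∑ i, κ i)) := by gcongr
    _ ≤ _ := by
        rw [← ENNReal.ofReal_mul (Real.exp_pos _).le, ← Real.exp_add]
        refine ENNReal.ofReal_le_ofReal (Real.exp_le_exp.2 (by linarith))

theorem gaussianVec_sum_norm_sq_ge (m : ℕ) {c : ℝ} (h0 : 0 < c) (h1 : c ≤ 1) :
    gaussianVec m {x | (1 + c) * m ≤ ∑ i, ‖x i‖ ^ 2}
      ≤ ENNReal.ofReal (Real.exp (-(c ^ 2 / 8) * m)) := by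
  -- The parameter `l = c / 4` minimises `l + 2 * l ^ 2 - l * (1 + c)`, with value `-c ^ 2 / 8`.
  have h := gaussianVec_chernoff (m := m) (F := fun _ z => c / 4 * ‖z‖ ^ 2)
    (fun _ => by fun_prop) (fun _ => lintegral_exp_mul_norm_sq_le (l := c / 4) (by linarith))
    (s := c / 4 * ((1 + c) * m)) (r := -(c ^ 2 / 8) * m) (by simp; ring_nf; rfl)
  refine le_trans (measure_mono fun x hx => ?_) h
  simp only [Set.mem_ofPred_eq, ← Finset.mul_sum] at hx ⊢
  gcongr

theorem gaussianVec_sum_norm_sq_le (m : ℕ) {c : ℝ} (h0 : 0 < c) :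
    gaussianVec m {x | ∑ i, ‖x i‖ ^ 2 ≤ (1 - c) * m}
      ≤ ENNReal.ofReal (Real.exp (-(c ^ 2 / 8) * m)) := by
  have h := gaussianVec_chernoff (m := m) (F := fun _ z => -(c / 4) * ‖z‖ ^ 2)
    (fun _ => by fun_prop) (fun _ => lintegral_exp_mul_norm_sq_le (l := -(c / 4)) (by linarith))
    (s := -(c / 4) * ((1 - c) * m)) (r := -(c ^ 2 / 8) * m) (by simp; ring_nf; rfl)
  refine le_trans (measure_mono fun x hx => ?_) h
  simp only [Set.mem_ofPred_eq, ← Finset.mul_sum] at hx ⊢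
  nlinarith

theorem gaussianVec_sum_weighted_ge (m : ℕ) {w : Fin m → ℝ} (hw0 : ∀ i, 0 ≤ w i)
    (hw1 : ∀ i, w i ≤ 10) (hw : ∑ i, w i ≤ 11 / 10 * m) :
    gaussianVec m {x | 23 / 20 * m ≤ ∑ i, w i * ‖x i‖ ^ 2}
      ≤ ENNReal.ofReal (Real.exp (-(1 / 50000) * m)) := by
  have h := gaussianVec_chernoff (m := m) (F := fun i z => 1 / 1000 * w i * ‖z‖ ^ 2)
    (fun _ => by fun_prop)
    (fun i => lintegral_exp_mul_norm_sq_le (l := 1 / 1000 * w i) (by linarith [hw1 i]))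
    (s := 1 / 1000 * (23 / 20 * m)) (r := -(1 / 50000) * m) (by
      have : ∀ i, 1 / 1000 * w i + 2 * (1 / 1000 * w i) ^ 2 ≤ 51 / 50000 * w i := fun i => by
        nlinarith [mul_nonneg (hw0 i) (sub_nonneg.2 (hw1 i))]
      have h2 := Finset.sum_le_sum fun i (_ : i ∈ Finset.univ) => this i
      rw [← Finset.mul_sum] at h2
      have : (0 : ℝ) ≤ m := by positivity
      linarith)
  refine le_trans (measure_mono fun x hx => ?_) h
  simp only [Set.mem_ofPred_eq, mul_assoc, ← Finset.mul_sum] at hx ⊢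
  linarith

theorem gaussianVec_sum_im_sq_ge (m : ℕ) {u : Fin m → ℂ} (hu : ∀ i, ‖u i‖ = 1) {c : ℝ}
    (h0 : 0 < c) (h1 : c ≤ 1) :
    gaussianVec m {x | (1 / 2 + c) * m ≤ ∑ i, (u i * x i).im ^ 2}
      ≤ ENNReal.ofReal (Real.exp (-(c ^ 2 / 4) * m)) := by
  -- Rotation invariance removes the unimodular factors `u i`.
  have h := gaussianVec_chernoff (m := m) (F := fun i z => c / 2 * (u i * z).im ^ 2)
    (fun _ => by fun_prop) (κ := fun _ => c / 2 / 2 + (c / 2) ^ 2) (fun i => by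
      have := lintegral_exp_mul_im_sq_le (l := c / 2) (by linarith)
      rw [← stdComplexGaussian_map_mul (hu i), lintegral_map (by fun_prop) (by fun_prop)] at this
      exact this)
    (s := c / 2 * ((1 / 2 + c) * m)) (r := -(c ^ 2 / 4) * m) (by simp; ring_nf; rfl)
  refine le_trans (measure_mono fun x hx => ?_) h
  simp only [Set.mem_ofPred_eq, ← Finset.mul_sum] at hx ⊢
  gcongr

/-- Bounding the excess above `T` controls the energy on every small set of coordinates at once,
without a union bound over subsets. The estimate is `exp ((y - T)⁺ / 2) ≤ 1 + exp (-T / 2) * exp (y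
/ 2)` with `y = ‖z‖ ^ 2`. -/
theorem gaussianVec_sum_excess_ge (m : ℕ) (c T : ℝ) :
    gaussianVec m {x | c * m ≤ ∑ i, max (‖x i‖ ^ 2 - T) 0}
      ≤ ENNReal.ofReal (Real.exp (-(c / 2 - 2 * Real.exp (-(T / 2))) * m)) := by
  have h := gaussianVec_chernoff (m := m) (F := fun i z => 1 / 2 * max (‖z‖ ^ 2 - T) 0)
    (fun _ => by fun_prop) (κ := fun _ => 2 * Real.exp (-(T / 2))) (fun i => by
      calc _ ≤ ∫⁻ z : ℂ, (1 + ENNReal.ofReal (Real.exp (-(T / 2)))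
            * ENNReal.ofReal (Real.exp (1 / 2 * ‖z‖ ^ 2))) ∂stdComplexGaussian := by
            refine lintegral_mono fun z => ?_
            rw [← ENNReal.ofReal_mul (Real.exp_pos _).le, ← Real.exp_add, ← ENNReal.ofReal_one,
              ← ENNReal.ofReal_add zero_le_one (Real.exp_pos _).le]
            refine ENNReal.ofReal_le_ofReal ?_
            rcases le_total (‖z‖ ^ 2 - T) 0 with hz | hz
            · rw [max_eq_right hz]
              simp [(Real.exp_pos _).le]
            · rw [max_eq_left hz]
              have : 1 / 2 * (‖z‖ ^ 2 - T) = -(T / 2) + 1 / 2 * ‖z‖ ^ 2 := by ring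
              rw [this]
              linarith
        _ = ENNReal.ofReal (1 + Real.exp (-(T / 2)) * 2) := by
            rw [lintegral_add_left (by fun_prop), lintegral_const_mul _ (by fun_prop),
              lintegral_exp_mul_norm_sq (by norm_num), ← ENNReal.ofReal_mul (Real.exp_pos _).le,
              lintegral_one, measure_univ, ← ENNReal.ofReal_one,
              ← ENNReal.ofReal_add zero_le_one (by positivity)]
            norm_num
        _ ≤ _ := by
            refine ENNReal.ofReal_le_ofReal ?_
            have := Real.add_one_le_exp (2 * Real.exp (-(T / 2)))
            linarith)
    (s := 1 / 2 * (c * m)) (r := -(c / 2 - 2 * Real.exp (-(T / 2))) * m) (by simp; ring_nf; rfl)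
  refine le_trans (measure_mono fun x hx => ?_) h
  simp only [Set.mem_ofPred_eq, ← Finset.mul_sum] at hx ⊢
  gcongr

/-- The exponential of the indicator is at most `1 + 5 * exp (-‖z‖ ^ 2 / τ ^ 2)`, as `exp 1 ≤ 1 + 5
/ exp 1`; the Gaussian integral of the last term is of order `τ ^ 2`. -/
theorem gaussianVec_card_small_ge (m : ℕ) {τ : ℝ} (hτ : 0 < τ) (s : ℝ) :
    gaussianVec m {x | s ≤ ∑ i, if ‖x i‖ < τ then (1 : ℝ) else 0}
      ≤ ENNReal.ofReal (Real.exp (5 * τ ^ 2 * m - s)) := by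
  refine gaussianVec_chernoff (m := m) (F := fun i z => if ‖z‖ < τ then (1 : ℝ) else 0)
    (fun _ => Measurable.ite (measurableSet_lt (by fun_prop) (by fun_prop)) (by fun_prop)
      (by fun_prop)) (κ := fun _ => 5 * τ ^ 2) (fun i => ?_)
    (r := 5 * τ ^ 2 * m - s) (by simp; ring_nf; rfl)
  calc _ ≤ ∫⁻ z : ℂ, (1 + ENNReal.ofReal 5
        * ENNReal.ofReal (Real.exp (-(1 / τ ^ 2) * ‖z‖ ^ 2))) ∂stdComplexGaussian := by
        refine lintegral_mono fun z => ?_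
        rw [← ENNReal.ofReal_mul (by norm_num), ← ENNReal.ofReal_one,
          ← ENNReal.ofReal_add zero_le_one (by positivity)]
        refine ENNReal.ofReal_le_ofReal ?_
        split_ifs with hz
        · have h1 : -1 ≤ -(1 / τ ^ 2) * ‖z‖ ^ 2 := by
            have : ‖z‖ ^ 2 ≤ τ ^ 2 := by gcongr
            have : ‖z‖ ^ 2 / τ ^ 2 ≤ 1 := (div_le_one (by positivity)).2 this
            have e : -(1 / τ ^ 2) * ‖z‖ ^ 2 = -(‖z‖ ^ 2 / τ ^ 2) := by ring
            rw [e]; linarith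
          have h2 := Real.exp_le_exp.2 h1
          have h3 := Real.exp_one_lt_d9
          have h4 : Real.exp (-1) * Real.exp 1 = 1 := by rw [← Real.exp_add]; simp
          have h5 := Real.exp_pos (-1)
          nlinarith
        · simp [(Real.exp_pos _).le]
    _ = ENNReal.ofReal (1 + 5 * (1 / (1 + 1 / τ ^ 2))) := by
        have : 0 < 1 / τ ^ 2 := by positivity
        rw [lintegral_add_left (by fun_prop), lintegral_const_mul _ (by fun_prop),
          lintegral_exp_mul_norm_sq (by linarith), ← ENNReal.ofReal_mul (by norm_num),
          lintegral_one, measure_univ, ← ENNReal.ofReal_one,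
          ← ENNReal.ofReal_add zero_le_one (by rw [sub_neg_eq_add]; positivity), sub_neg_eq_add]
    _ ≤ _ := by
        refine ENNReal.ofReal_le_ofReal ?_
        have h1 := Real.add_one_le_exp (5 * τ ^ 2)
        have h2 : 1 / (1 + 1 / τ ^ 2) ≤ τ ^ 2 := by
          rw [div_le_iff₀ (by positivity)]
          have : τ ^ 2 * (1 + 1 / τ ^ 2) = τ ^ 2 + 1 := by field_simp
          rw [this]
          have : 0 < τ ^ 2 := by positivity
          linarith
        linarith

theorem gaussianVec_sum_re_ge (m : ℕ) (c : Fin m → ℂ) (l s : ℝ) (hl : 0 ≤ l) :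
    gaussianVec m {x | s ≤ ∑ i, (c i * x i).re}
      ≤ ENNReal.ofReal (Real.exp (l ^ 2 * (∑ i, ‖c i‖ ^ 2) / 4 - l * s)) := by
  have h := gaussianVec_chernoff (m := m) (F := fun i z => (((l : ℂ) * c i) * z).re)
    (fun _ => by fun_prop) (fun i => (lintegral_exp_re_mul ((l : ℂ) * c i)).le)
    (s := l * s) (r := l ^ 2 * (∑ i, ‖c i‖ ^ 2) / 4 - l * s) (by
      rw [← Finset.sum_div, Finset.mul_sum]
      simp [mul_pow])
  refine le_trans (measure_mono fun x hx => ?_) h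
  simp only [Set.mem_ofPred_eq, mul_assoc, Complex.re_ofReal_mul, ← Finset.mul_sum] at hx ⊢
  gcongr

/-- The truncated fourth power dominates `‖z‖ ^ 4 - ‖z‖ ^ 8 / 64`, whose mean `2 - 24 / 64 = 13 / 8`
exceeds `3 / 2`. It is at most `64`, so the quadratic term in the expansion of the exponential only
lowers the slope `1000 / 10 ^ 6` to `936 / 10 ^ 6`. -/
theorem gaussianVec_sum_truncated_le (m : ℕ) :
    gaussianVec m {x | ∑ i, (if ‖x i‖ ^ 2 ≤ 8 then ‖x i‖ ^ 4 else 0) ≤ 3 / 2 * m}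
      ≤ ENNReal.ofReal (Real.exp (-(1 / 50000) * m)) := by
  have h := gaussianVec_chernoff (m := m)
    (F := fun i z => -(1 / 1000) * (if ‖z‖ ^ 2 ≤ 8 then ‖z‖ ^ 4 else 0))
    (fun _ => (Measurable.ite (measurableSet_le (by fun_prop) (by fun_prop)) (by fun_prop)
      (by fun_prop)).const_mul _) (κ := fun _ => -(1521 / 1000000)) (fun i => by
      have hp : ∀ z : ℂ, Real.exp (-(1 / 1000) * (if ‖z‖ ^ 2 ≤ 8 then ‖z‖ ^ 4 else 0))
          ≤ 1 - 936 / 1000000 * (‖z‖ ^ (2 * 2) - ‖z‖ ^ (2 * 4) / 64) := fun z => by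
        have h2 : (0 : ℝ) ≤ ‖z‖ ^ 2 := by positivity
        have e1 : ‖z‖ ^ (2 * 2) = (‖z‖ ^ 2) ^ 2 := by rw [← pow_mul]
        rw [show ‖z‖ ^ 4 = ‖z‖ ^ (2 * 2) from rfl]
        have e2 : ‖z‖ ^ (2 * 4) = ((‖z‖ ^ 2) ^ 2) ^ 2 := by rw [← pow_mul, ← pow_mul]
        rw [e1, e2]
        generalize ‖z‖ ^ 2 = y at *
        split_ifs with hy
        · have hy2 : y ^ 2 ≤ 64 := by nlinarith
          generalize hY : y ^ 2 = Y at *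
          have hY0 : 0 ≤ Y := by rw [← hY]; positivity
          have h3 : Real.exp (-(1 / 1000) * Y)
              ≤ 1 + -(1 / 1000) * Y + (-(1 / 1000) * Y) ^ 2 := by
            have := Real.abs_exp_sub_one_sub_id_le (x := -(1 / 1000) * Y) (by
              rw [abs_le]; constructor <;> linarith)
            have := (abs_le.1 this).2
            linarith
          nlinarith
        · have hy2 : 64 ≤ y ^ 2 := by nlinarith
          simp only [mul_zero, Real.exp_zero]
          nlinarith
      have i1 := integrable_norm_pow 2
      have i2 := (integrable_norm_pow 4).div_const 64
      have i3 : Integrable (fun z : ℂ => 936 / 1000000 * (‖z‖ ^ (2 * 2) - ‖z‖ ^ (2 * 4) / 64))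
          stdComplexGaussian := (i1.sub i2).const_mul (936 / 1000000)
      have i4 : Integrable
          (fun z : ℂ => 1 - 936 / 1000000 * (‖z‖ ^ (2 * 2) - ‖z‖ ^ (2 * 4) / 64))
          stdComplexGaussian := (integrable_const 1).sub i3
      calc _ ≤ ∫⁻ z : ℂ, ENNReal.ofReal
            (1 - 936 / 1000000 * (‖z‖ ^ (2 * 2) - ‖z‖ ^ (2 * 4) / 64)) ∂stdComplexGaussian :=
            lintegral_mono fun z => ENNReal.ofReal_le_ofReal (hp z)
        _ = ENNReal.ofReal (∫ z : ℂ,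
            (1 - 936 / 1000000 * (‖z‖ ^ (2 * 2) - ‖z‖ ^ (2 * 4) / 64)) ∂stdComplexGaussian) :=
            (ofReal_integral_eq_lintegral_ofReal i4 (Filter.Eventually.of_forall fun z =>
              (Real.exp_pos _).le.trans (hp z))).symm
        _ ≤ _ := by
            refine ENNReal.ofReal_le_ofReal ?_
            have e : ∫ z : ℂ,
              (1 - 936 / 1000000 * (‖z‖ ^ (2 * 2) - ‖z‖ ^ (2 * 4) / 64)) ∂stdComplexGaussian
              = 1 - 1521 / 1000000 := by
              rw [integral_sub (integrable_const _) i3, integral_const_mul, integral_sub i1 i2,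
                integral_div, integral_norm_pow, integral_norm_pow]
              simp [Nat.factorial]
              norm_num
            rw [e]
            have := Real.add_one_le_exp (-(1521 / 1000000 : ℝ))
            linarith)
    (s := -(1 / 1000) * (3 / 2 * m)) (r := -(1 / 50000) * m) (by
      have : (0 : ℝ) ≤ m := by positivity
      simp; linarith)
  refine le_trans (measure_mono fun x hx => ?_) h
  simp only [Set.mem_ofPred_eq, ← Finset.mul_sum] at hx ⊢
  linarith

/-! ### Perturbation of the phase. -/

theorem norm_phase (z : ℂ) : ‖phase z‖ = 1 := by
  unfold phase
  split_ifs with h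
  · simp
  · rw [norm_div, Complex.norm_real, norm_norm, div_self (norm_ne_zero_iff.2 h)]

theorem norm_mul_phase (z : ℂ) : (‖z‖ : ℂ) * phase z = z := by
  unfold phase
  split_ifs with h
  · simp [h]
  · rw [mul_div_cancel₀ _ (by simpa using h)]

theorem phase_mul {z w : ℂ} (hz : z ≠ 0) (hw : w ≠ 0) : phase (z * w) = phase z * phase w := by
  simp only [phase, hz, hw, mul_eq_zero, or_self, if_false, norm_mul, Complex.ofReal_mul]
  rw [mul_div_mul_comm]

theorem phase_ofReal_mul {c : ℝ} (hc : 0 < c) (z : ℂ) : phase (c * z) = phase z := by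
  by_cases hz : z = 0
  · simp [hz]
  · rw [phase_mul (by exact_mod_cast hc.ne') hz, phase, if_neg (by exact_mod_cast hc.ne'),
      Complex.norm_real, Real.norm_of_nonneg hc.le, div_self (by exact_mod_cast hc.ne'), one_mul]

theorem exists_exp_eq_of_norm_eq_one {u : ℂ} (hu : ‖u‖ = 1) :
    ∃ φ : ℝ, Complex.exp (φ * Complex.I) = u := by
  refine ⟨u.arg, ?_⟩
  have := Complex.norm_mul_exp_arg_mul_I u
  rwa [hu, Complex.ofReal_one, one_mul] at this

/-- Near `1`, the phase only varies with the imaginary part. -/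
theorem norm_one_sub_phase_le {y : ℂ} (hy : ‖y‖ ≤ 1 / 10) :
    ‖1 - phase (1 + y)‖ ≤ 10 / 9 * |y.im| := by
  set w := 1 + y with hw
  have hre : 9 / 10 ≤ w.re := by
    have := (abs_le.1 ((Complex.abs_re_le_norm y).trans hy)).1
    simp [hw]; linarith
  have hr : w.re ≤ ‖w‖ := Complex.re_le_norm w
  have hr2 : ‖w‖ ^ 2 = w.re ^ 2 + w.im ^ 2 := by
    rw [← Complex.normSq_eq_norm_sq, Complex.normSq_apply]; ring
  have him : y.im = w.im := by simp [hw]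
  have hw0 : w ≠ 0 := by rintro h; rw [h] at hre; norm_num at hre
  have h1 : ‖w‖ * ‖1 - phase w‖ = ‖(‖w‖ : ℂ) - w‖ := by
    have : (‖w‖ : ℂ) - w = ‖w‖ * (1 - phase w) := by rw [mul_sub, mul_one, norm_mul_phase]
    rw [this, norm_mul, Complex.norm_real, norm_norm]
  have h2 : ‖(‖w‖ : ℂ) - w‖ ^ 2 = 2 * ‖w‖ * (‖w‖ - w.re) := by
    rw [← Complex.normSq_eq_norm_sq, Complex.normSq_apply]
    simp
    linarith
  have h3 : (‖w‖ * ‖1 - phase w‖) ^ 2 = 2 * ‖w‖ * (‖w‖ - w.re) := by rw [h1, h2]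
  have hpos : 0 < ‖w‖ := by linarith
  have h4 : ‖w‖ * ‖1 - phase w‖ ^ 2 = 2 * (‖w‖ - w.re) := by
    have : ‖w‖ * (‖w‖ * ‖1 - phase w‖ ^ 2) = ‖w‖ * (2 * (‖w‖ - w.re)) := by
      linear_combination h3
    exact mul_left_cancel₀ hpos.ne' this
  rw [him]
  refine abs_le_of_sq_le_sq' ?_ (by positivity) |>.2
  rw [mul_pow, sq_abs]
  -- Multiplying by the conjugate `‖w‖ + w.re` turns the gap `‖w‖ - w.re` into `w.im ^ 2`; the
  -- prefactor is at least `2 * (9 / 10) ^ 2`, which gives exactly `10 / 9`.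
  have h5 : ‖w‖ * (‖w‖ + w.re) * ‖1 - phase w‖ ^ 2 = 2 * w.im ^ 2 := by
    linear_combination (‖w‖ + w.re) * h4 + 2 * hr2
  have h6 : 162 / 100 ≤ ‖w‖ * (‖w‖ + w.re) := by nlinarith
  nlinarith [mul_le_mul_of_nonneg_right h6 (sq_nonneg ‖1 - phase w‖)]

/-- How the phase of `α g + h` deviates from that of `α g`, weighted by the modulus of `g`. -/
theorem norm_phase_deviation_le {α : ℂ} (hα : α ≠ 0) (g h : ℂ) :
    ‖phase α * g - ‖g‖ * phase (α * (g + h))‖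
      ≤ 10 / 9 * |(conj (phase g) * h).im| + if ‖g‖ < 10 * ‖h‖ then 20 * ‖h‖ else 0 := by
  split_ifs with hgh
  · have h1 : ‖phase α * g - ‖g‖ * phase (α * (g + h))‖ ≤ 2 * ‖g‖ := by
      refine (norm_sub_le _ _).trans ?_
      rw [norm_mul, norm_mul, norm_phase, norm_phase, Complex.norm_real, norm_norm]
      linarith
    have h2 : 0 ≤ 10 / 9 * |(conj (phase g) * h).im| := by positivity
    linarith
  · push Not at hgh
    rw [add_zero]
    by_cases hg : g = 0
    · simp only [hg, norm_zero, mul_zero, Complex.ofReal_zero, zero_mul, sub_zero]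
      positivity
    have hy : ‖h / g‖ ≤ 1 / 10 := by
      rw [norm_div, div_le_iff₀ (norm_pos_iff.2 hg)]; linarith
    have h0 : (1 : ℂ) + h / g ≠ 0 := by
      intro h0
      have h1 : h / g = -1 := by linear_combination h0
      rw [h1] at hy; norm_num at hy
    have e1 : α * (g + h) = α * (g * (1 + h / g)) := by field_simp
    have e2 : phase (α * (g + h)) = phase α * (phase g * phase (1 + h / g)) := by
      rw [e1, phase_mul hα (mul_ne_zero hg h0), phase_mul hg h0]
    have e3 : phase α * g - ‖g‖ * phase (α * (g + h))
        = phase α * g * (1 - phase (1 + h / g)) := by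
      rw [e2]
      linear_combination -(phase α * phase (1 + h / g)) * norm_mul_phase g
    rw [e3, norm_mul, norm_mul, norm_phase, one_mul]
    have e4 : (conj (phase g) * h).im = ‖g‖ * (h / g).im := by
      have : conj (phase g) * h = ‖g‖ * (h / g) := by
        have hp := norm_mul_phase g
        have hc : conj (phase g) * phase g = 1 := by
          rw [Complex.conj_mul', norm_phase]; simp
        rw [mul_div_assoc', eq_div_iff hg]
        linear_combination (-(conj (phase g) * h)) * hp + (‖g‖ * h : ℂ) * hc
      rw [this, Complex.im_ofReal_mul]
    rw [e4, abs_mul, abs_of_nonneg (norm_nonneg g)]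
    have := mul_le_mul_of_nonneg_left (norm_one_sub_phase_le hy) (norm_nonneg g)
    linarith

/-! ### Pseudo-inverse, top eigenvectors and the initialization matrix. -/

section Matrices

variable {m n : ℕ}

theorem toEuclideanLin_mul_apply {k : ℕ} (A : Matrix (Fin m) (Fin n) ℂ)
    (B : Matrix (Fin n) (Fin k) ℂ) (v : EuclideanSpace ℂ (Fin k)) :
    toEuclideanLin (A * B) v = toEuclideanLin A (toEuclideanLin B v) := by
  simp [toLpLin_apply, mulVec_mulVec]

theorem inner_toEuclideanLin (A : Matrix (Fin m) (Fin n) ℂ) (v : EuclideanSpace ℂ (Fin n))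
    (y : EuclideanSpace ℂ (Fin m)) :
    inner ℂ (toEuclideanLin A v) y = inner ℂ v (toEuclideanLin Aᴴ y) := by
  rw [toEuclideanLin_conjTranspose_eq_adjoint, LinearMap.adjoint_inner_right]

/-- `A * B` is a self-adjoint idempotent, so `‖p‖ ^ 2 = ⟪p, y⟫` and Cauchy-Schwarz applies. -/
theorem IsMoorePenrose.norm_le {A : Matrix (Fin m) (Fin n) ℂ} {B : Matrix (Fin n) (Fin m) ℂ}
    (h : IsMoorePenrose A B) (y : EuclideanSpace ℂ (Fin m)) :
    ‖toEuclideanLin A (toEuclideanLin B y)‖ ≤ ‖y‖ := by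
  set p := toEuclideanLin A (toEuclideanLin B y) with hp
  have hAB : p = toEuclideanLin (A * B) y := (toEuclideanLin_mul_apply _ _ _).symm
  have h1 : inner ℂ p p = inner ℂ p y := by
    conv_lhs => rw [hAB, inner_toEuclideanLin, h.herm_left, ← toEuclideanLin_mul_apply,
      ← Matrix.mul_assoc, h.mul_mul_left]
    rw [← hAB]
    have : inner ℂ p y = inner ℂ y (toEuclideanLin (A * B)ᴴ y) := by
      rw [hAB, inner_toEuclideanLin]
    rw [this, h.herm_left, hAB]
  have h2 : ‖p‖ ^ 2 ≤ ‖p‖ * ‖y‖ := by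
    have h3 : ((‖p‖ ^ 2 : ℝ) : ℂ) = inner ℂ p y := by
      rw [← h1, inner_self_eq_norm_sq_to_K]; norm_cast
    have h4 := norm_inner_le_norm (𝕜 := ℂ) p y
    rw [← h3, Complex.norm_real, Real.norm_of_nonneg (by positivity)] at h4
    exact h4
  by_cases h0 : ‖p‖ = 0
  · rw [h0]; positivity
  · have : 0 < ‖p‖ := lt_of_le_of_ne (norm_nonneg _) (Ne.symm h0)
    nlinarith

/-- From `A A† A = A`, the image under `A` of the error is `A A† (A x - y)`, an orthogonal
projection of the residual. -/
theorem norm_sub_pinv_le {A : Matrix (Fin m) (Fin n) ℂ} {c : ℝ}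
    (hc : ∀ v : EuclideanSpace ℂ (Fin n), c * ‖v‖ ≤ ‖toEuclideanLin A v‖)
    (x : EuclideanSpace ℂ (Fin n)) (y : EuclideanSpace ℂ (Fin m)) :
    c * ‖x - toEuclideanLin (pinv A) y‖ ≤ ‖toEuclideanLin A x - y‖ := by
  refine (hc _).trans ?_
  have hs := pinv_spec A
  have h1 : toEuclideanLin A (x - toEuclideanLin (pinv A) y)
      = toEuclideanLin A (toEuclideanLin (pinv A) (toEuclideanLin A x - y)) := by
    rw [map_sub, map_sub, map_sub, ← toEuclideanLin_mul_apply (pinv A) A,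
      ← toEuclideanLin_mul_apply A (pinv A * A), ← Matrix.mul_assoc, hs.mul_mul_left]
  rw [h1]
  exact hs.norm_le _

theorem IsMainEigenvector.exists_rayleigh_le {Y : Matrix (Fin n) (Fin n) ℂ}
    {z : EuclideanSpace ℂ (Fin n)} (hz : IsMainEigenvector Y z) (hY : Y.IsHermitian) :
    ∃ μ : ℝ, z ≠ 0 ∧ toEuclideanLin Y z = (μ : ℂ) • z ∧
      ∀ p, (inner ℂ p (toEuclideanLin Y p)).re ≤ μ * ‖p‖ ^ 2 := by
  obtain ⟨μ, h1, h2⟩ := hz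
  refine ⟨μ, h1.2, h1.apply_eq_smul, fun p => ?_⟩
  have hsym : (toEuclideanLin Y).IsSymmetric := isSymmetric_toEuclideanLin_iff.2 hY
  have : Nontrivial (EuclideanSpace ℂ (Fin n)) := ⟨⟨z, 0, h1.2⟩⟩
  -- In finite dimension the supremum of the Rayleigh quotient is itself an eigenvalue, hence at
  -- most `μ`.
  have h3 := h2 _ hsym.hasEigenvalue_iSup_of_finiteDimensional
  by_cases hp : p = 0
  · simp [hp]
  have hbdd : BddAbove (Set.range fun x : { x : EuclideanSpace ℂ (Fin n) // x ≠ 0 } =>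
      RCLike.re (inner ℂ (toEuclideanLin Y x) (x : EuclideanSpace ℂ (Fin n))) /
        ‖(x : EuclideanSpace ℂ (Fin n))‖ ^ 2) := by
    refine ⟨‖LinearMap.toContinuousLinearMap (toEuclideanLin Y)‖, ?_⟩
    rintro _ ⟨x, rfl⟩
    exact (le_abs_self _).trans
      ((LinearMap.toContinuousLinearMap (toEuclideanLin Y)).rayleighQuotient_le_norm x)
  have h4 := (le_ciSup hbdd ⟨p, hp⟩).trans h3
  have hpos : 0 < ‖p‖ ^ 2 := by positivity
  rw [div_le_iff₀ hpos] at h4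
  rw [← inner_conj_symm, Complex.conj_re]
  exact h4

theorem IsMainEigenvector.of_smul {Y : Matrix (Fin n) (Fin n) ℂ}
    {z : EuclideanSpace ℂ (Fin n)} {c : ℝ} (hc : 0 < c)
    (hz : IsMainEigenvector ((c : ℂ) • Y) z) : IsMainEigenvector Y z := by
  obtain ⟨μ, h1, h2⟩ := hz
  have hc' : (c : ℂ) ≠ 0 := by exact_mod_cast hc.ne'
  refine ⟨c⁻¹ * μ, ⟨?_, h1.2⟩, fun ν hν => ?_⟩
  · rw [Module.End.mem_eigenspace_iff]
    have h3 := h1.apply_eq_smul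
    rw [map_smul, LinearMap.smul_apply] at h3
    rw [Complex.ofReal_mul, mul_smul, ← h3, smul_smul, Complex.ofReal_inv, inv_mul_cancel₀ hc',
      one_smul]
  · obtain ⟨p, hp⟩ := hν.exists_hasEigenvector
    have h3 : Module.End.HasEigenvalue (toEuclideanLin ((c : ℂ) • Y)) ((c * ν : ℝ) : ℂ) := by
      refine Module.End.hasEigenvalue_of_hasEigenvector (x := p) ⟨?_, hp.2⟩
      rw [Module.End.mem_eigenspace_iff, map_smul, LinearMap.smul_apply, hp.apply_eq_smul,
        smul_smul, Complex.ofReal_mul]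
    have h4 := h2 _ h3
    rw [inv_mul_eq_div, le_div_iff₀ hc, mul_comm]
    exact h4

/-- The truncated weights `bᵢ² 1_{bᵢ² ≤ (9/m) ∑ⱼ bⱼ²}`. -/
noncomputable def truncWeight (b : Fin m → ℝ) (i : Fin m) : ℝ :=
  if b i ^ 2 ≤ 9 / (m : ℝ) * ∑ j, b j ^ 2 then b i ^ 2 else 0

theorem truncWeight_nonneg (b : Fin m → ℝ) (i : Fin m) : 0 ≤ truncWeight b i := by
  rw [truncWeight]
  split_ifs <;> positivity

theorem truncWeight_le_sq (b : Fin m → ℝ) (i : Fin m) : truncWeight b i ≤ b i ^ 2 := by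
  rw [truncWeight]
  split_ifs
  · exact le_rfl
  · positivity

theorem truncWeight_le_ten (hm : 0 < m) {b : Fin m → ℝ} (hb : ∑ i, b i ^ 2 ≤ (1 + 1 / 10) * m)
    (i : Fin m) : truncWeight b i ≤ 10 := by
  have hmpos : (0 : ℝ) < m := by exact_mod_cast hm
  rw [truncWeight]
  split_ifs with h
  · refine h.trans ?_
    rw [div_mul_eq_mul_div, div_le_iff₀ hmpos]
    linarith
  · norm_num

theorem initMatrix_eq (a : Fin m → EuclideanSpace ℂ (Fin n)) (b : Fin m → ℝ) :
    initMatrix a b = (1 / (m : ℂ)) • ∑ i, (truncWeight b i : ℂ) •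
      vecMulVec (fun k => a i k) (fun k => conj (a i k)) := by
  unfold initMatrix truncWeight
  congr 1
  refine Finset.sum_congr rfl fun i _ => ?_
  congr 1
  split_ifs <;> simp

theorem inner_initMatrix (a : Fin m → EuclideanSpace ℂ (Fin n)) (b : Fin m → ℝ)
    (p q : EuclideanSpace ℂ (Fin n)) :
    inner ℂ p (toEuclideanLin (initMatrix a b) q) = (1 / (m : ℂ)) * ∑ i, (truncWeight b i : ℂ) *
      (conj (toEuclideanLin (measMatrix a) p i) * toEuclideanLin (measMatrix a) q i) := by
  rw [initMatrix_eq, map_smul, LinearMap.smul_apply, inner_smul_right, map_sum,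
    LinearMap.sum_apply, inner_sum]
  congr 1
  refine Finset.sum_congr rfl fun i _ => ?_
  rw [map_smul, LinearMap.smul_apply, inner_smul_right]
  congr 1
  simp only [measMatrix_apply, map_sum, map_mul, Complex.conj_conj]
  rw [PiLp.inner_apply]
  simp only [toLpLin_apply, vecMulVec_mulVec, dotProduct, Pi.smul_apply,
    MulOpposite.smul_eq_mul_unop, MulOpposite.unop_op, RCLike.inner_apply, Finset.sum_mul]
  refine Finset.sum_congr rfl fun k _ => ?_
  ring

theorem isHermitian_initMatrix (a : Fin m → EuclideanSpace ℂ (Fin n)) (b : Fin m → ℝ) :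
    (initMatrix a b).IsHermitian := by
  rw [initMatrix_eq, IsHermitian, conjTranspose_smul, conjTranspose_sum]
  congr 1
  · simp
  refine Finset.sum_congr rfl fun i _ => ?_
  rw [conjTranspose_smul]
  congr 1
  · simp
  ext j k
  simp [vecMulVec_apply, mul_comm]

end Matrices

/-! ### Convergence for good sensing vectors. -/

section Deterministic

variable {m n : ℕ}

/-- The deterministic properties of the sensing vectors, relative to a unit vector `x`, under which
alternating projections with truncated spectral initialization converge to `x`. -/
structure GoodSensing (β τ κ : ℝ) (a : Fin m → EuclideanSpace ℂ (Fin n))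
    (x : EuclideanSpace ℂ (Fin n)) : Prop where
  lower : ∀ v, 19 / 20 * √m * ‖v‖ ≤ ‖toEuclideanLin (measMatrix a) v‖
  upper : ∀ v, ‖toEuclideanLin (measMatrix a) v‖ ≤ 2 * √m * ‖v‖
  im_le : ∀ v, inner ℂ x v = 0 →
    ∑ i, (conj (phase (toEuclideanLin (measMatrix a) x i)) *
      toEuclideanLin (measMatrix a) v i).im ^ 2 ≤ (18 / 25 * √m * ‖v‖) ^ 2
  sparse_le : ∀ S : Finset (Fin m), (S.card : ℝ) ≤ β * m → ∀ v,
    ∑ i ∈ S, ‖toEuclideanLin (measMatrix a) v i‖ ^ 2 ≤ (1 / 1000 * √m * ‖v‖) ^ 2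
  card_small_le :
    ∑ i, (if ‖toEuclideanLin (measMatrix a) x i‖ < τ then (1 : ℝ) else 0) ≤ β / 2 * m
  rayleigh_self : 3 / 2 * m ≤
    ∑ i, truncWeight (measurements a x) i * ‖toEuclideanLin (measMatrix a) x i‖ ^ 2
  rayleigh_orthogonal : ∀ v, inner ℂ x v = 0 →
    ∑ i, truncWeight (measurements a x) i * ‖toEuclideanLin (measMatrix a) v i‖ ^ 2
      ≤ 6 / 5 * m * ‖v‖ ^ 2
  cross_le : ∀ v, inner ℂ x v = 0 →
    ∑ i, ((truncWeight (measurements a x) i : ℂ) *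
      conj (toEuclideanLin (measMatrix a) x i) * toEuclideanLin (measMatrix a) v i).re
        ≤ κ * m * ‖v‖

theorem norm_le_add_of_forall_le {e : EuclideanSpace ℂ (Fin m)} {p q : Fin m → ℝ} {P Q : ℝ}
    (hP : 0 ≤ P) (hQ : 0 ≤ Q) (hp : ∑ i, p i ^ 2 ≤ P ^ 2) (hq : ∑ i, q i ^ 2 ≤ Q ^ 2)
    (h : ∀ i, ‖e i‖ ≤ p i + q i) : ‖e‖ ≤ P + Q := by
  have h1 : ∀ (r : Fin m → ℝ) (R : ℝ), 0 ≤ R → ∑ i, r i ^ 2 ≤ R ^ 2 →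
      ‖(WithLp.toLp 2 r : EuclideanSpace ℝ (Fin m))‖ ≤ R := fun r R hR hr => by
    refine abs_le_of_sq_le_sq' ?_ hR |>.2
    rw [EuclideanSpace.norm_sq_eq]
    simpa using hr
  have h2 : ‖e‖ ≤ ‖(WithLp.toLp 2 p + WithLp.toLp 2 q : EuclideanSpace ℝ (Fin m))‖ := by
    refine abs_le_of_sq_le_sq' ?_ (norm_nonneg _) |>.2
    rw [EuclideanSpace.norm_sq_eq, EuclideanSpace.norm_sq_eq]
    refine Finset.sum_le_sum fun i _ => ?_
    gcongr
    exact (h i).trans (le_abs_self _)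
  exact h2.trans ((norm_add_le _ _).trans (add_le_add (h1 p P hP hp) (h1 q Q hQ hq)))

/-- One step of alternating projections contracts towards the signal. -/
theorem GoodSensing.norm_sub_altProjStep_le {β τ κ γ : ℝ}
    {a : Fin m → EuclideanSpace ℂ (Fin n)} {x : EuclideanSpace ℂ (Fin n)}
    (hm : 0 < m) (ha : GoodSensing β τ κ a x) (hτ : 0 < τ) (hγ : 800 * γ ^ 2 ≤ β * τ ^ 2)
    {α : ℂ} (hα : α ≠ 0) {v : EuclideanSpace ℂ (Fin n)} (hv : inner ℂ x v = 0)
    (hvα : ‖v‖ ≤ γ * ‖α‖) :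
    ‖phase α • x - altProjStep (measMatrix a) (measurements a x) (α • x + v)‖
      ≤ 7 / 8 * (‖v‖ / ‖α‖) := by
  set A := measMatrix a with hA
  set g := toEuclideanLin A x with hg
  set v' := α⁻¹ • v with hv'
  set h := toEuclideanLin A v' with hh
  have hn : ‖v'‖ = ‖v‖ / ‖α‖ := by rw [hv', norm_smul, norm_inv]; ring
  have hαpos : 0 < ‖α‖ := norm_pos_iff.2 hα
  have hnγ : ‖v'‖ ≤ γ := by rw [hn, div_le_iff₀ hαpos]; exact hvα
  have hxv' : inner ℂ x v' = 0 := by rw [hv', inner_smul_right, hv, mul_zero]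
  have hz : α • x + v = α • (x + v') := by
    rw [smul_add, hv', smul_smul, mul_inv_cancel₀ hα, one_smul]
  have hmpos : (0 : ℝ) < m := by exact_mod_cast hm
  have hs : 0 < √(m : ℝ) := Real.sqrt_pos.2 hmpos
  have hs2 : √(m : ℝ) ^ 2 = m := Real.sq_sqrt hmpos.le
  set S : Finset (Fin m) := {i | ‖g i‖ < 10 * ‖h i‖} with hS
  have hcard : (S.card : ℝ) ≤ β * m := by
    have h1 : (S.card : ℝ) = ∑ i, if ‖g i‖ < 10 * ‖h i‖ then (1 : ℝ) else 0 := by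
      rw [hS]; simp
    -- An exceptional coordinate has `‖g i‖ < τ` or `‖h i‖ > τ / 10`. Markov's inequality counts the
    -- latter: at most `400 * γ ^ 2 / τ ^ 2 * m`, which is the origin of the condition `hγ`.
    have h2 : ∀ i, (if ‖g i‖ < 10 * ‖h i‖ then (1 : ℝ) else 0)
        ≤ (if ‖g i‖ < τ then (1 : ℝ) else 0) + 100 / τ ^ 2 * ‖h i‖ ^ 2 := fun i => by
      have h0 : 0 ≤ 100 / τ ^ 2 * ‖h i‖ ^ 2 := by positivity
      split_ifs with h3 h4 h4
      · linarith
      · rw [zero_add, div_mul_eq_mul_div, le_div_iff₀ (by positivity)]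
        push Not at h4
        have : τ ≤ 10 * ‖h i‖ := h4.trans h3.le
        nlinarith
      · linarith
      · linarith
    have h3 : ∑ i, ‖h i‖ ^ 2 ≤ 4 * m * γ ^ 2 := by
      rw [← EuclideanSpace.norm_sq_eq]
      have : ‖h‖ ≤ 2 * √m * γ := (ha.upper v').trans (by gcongr)
      calc ‖h‖ ^ 2 ≤ (2 * √m * γ) ^ 2 := by gcongr
        _ = 4 * m * γ ^ 2 := by rw [mul_pow, mul_pow, hs2]; ring
    have h4 := Finset.sum_le_sum fun i (_ : i ∈ Finset.univ) => h2 i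
    rw [← h1, Finset.sum_add_distrib, ← Finset.mul_sum] at h4
    have h5 : 100 / τ ^ 2 * ∑ i, ‖h i‖ ^ 2 ≤ β / 2 * m := by
      rw [div_mul_eq_mul_div, div_le_iff₀ (by positivity)]
      nlinarith
    have := ha.card_small_le
    linarith
  -- Here `4 / 5 = 10 / 9 * (18 / 25)` comes from the imaginary parts and `1 / 50 = 20 / 1000` from
  -- the exceptional coordinates; divided by the lower bound `19 / 20`, the sum stays below `7 / 8`.
  have he : ‖toEuclideanLin A (phase α • x) -
      WithLp.toLp 2 fun i => (measurements a x i : ℂ) * phase (toEuclideanLin A (α • x + v) i)‖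
      ≤ 4 / 5 * √m * ‖v'‖ + 1 / 50 * √m * ‖v'‖ := by
    refine norm_le_add_of_forall_le (p := fun i => 10 / 9 * |(conj (phase (g i)) * h i).im|)
      (q := fun i => if ‖g i‖ < 10 * ‖h i‖ then 20 * ‖h i‖ else 0) (by positivity)
      (by positivity) ?_ ?_ fun i => ?_
    · have := ha.im_le v' hxv'
      simp only [mul_pow, sq_abs, ← Finset.mul_sum] at this ⊢
      linarith
    · have := ha.sparse_le S hcard v'
      have e : ∀ i, (if ‖g i‖ < 10 * ‖h i‖ then 20 * ‖h i‖ else 0) ^ 2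
          = if ‖g i‖ < 10 * ‖h i‖ then 400 * ‖h i‖ ^ 2 else 0 := fun i => by
        split_ifs <;> ring
      simp only [e, ← Finset.sum_filter, ← Finset.mul_sum]
      simp only [mul_pow] at this ⊢
      linarith
    · refine le_trans (le_of_eq ?_) (norm_phase_deviation_le hα (g i) (h i))
      rw [hz]
      simp [measurements, hg, hh, hA, ← mul_add]
  have hfin := norm_sub_pinv_le (A := A) ha.lower (phase α • x) (WithLp.toLp 2 fun i =>
    (measurements a x i : ℂ) * phase (toEuclideanLin A (α • x + v) i))
  rw [← hn]
  have h6 := hfin.trans he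
  unfold altProjStep
  have h7 : √(m : ℝ) * (19 / 20 * ‖phase α • x - toEuclideanLin (pinv A) (WithLp.toLp 2 fun i =>
    (measurements a x i : ℂ) * phase (toEuclideanLin A (α • x + v) i))‖)
      ≤ √(m : ℝ) * (41 / 50 * ‖v'‖) := by linarith
  have h8 := le_of_mul_le_mul_left h7 hs
  linarith [norm_nonneg v']

theorem exists_orthogonal_decomposition {x : EuclideanSpace ℂ (Fin n)} (hx : ‖x‖ = 1)
    (z : EuclideanSpace ℂ (Fin n)) :
    ∃ (α : ℂ) (v : EuclideanSpace ℂ (Fin n)), inner ℂ x v = 0 ∧ z = α • x + v := by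
  refine ⟨inner ℂ x z, z - inner ℂ x z • x, ?_, by abel⟩
  rw [inner_sub_right, inner_smul_right, inner_self_eq_norm_sq_to_K, hx]
  simp

/-- The spectral initialization is nearly collinear to the signal. -/
theorem GoodSensing.exists_decomposition_of_isMainEigenvector {β τ κ : ℝ}
    {a : Fin m → EuclideanSpace ℂ (Fin n)} {x z : EuclideanSpace ℂ (Fin n)}
    (hm : 0 < m) (hκ : 0 ≤ κ) (hx : ‖x‖ = 1) (ha : GoodSensing β τ κ a x)
    (hz : IsMainEigenvector (initMatrix a (measurements a x)) z) :
    ∃ (α : ℂ) (v : EuclideanSpace ℂ (Fin n)), α ≠ 0 ∧ inner ℂ x v = 0 ∧ z = α • x + v ∧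
      ‖v‖ ≤ 10 / 3 * κ * ‖α‖ := by
  obtain ⟨μ, hz0, hYz, hray⟩ := hz.exists_rayleigh_le (isHermitian_initMatrix _ _)
  obtain ⟨α, v, hv, hdec⟩ := exists_orthogonal_decomposition hx z
  set b := measurements a x with hb
  set Y := initMatrix a b with hY
  have hmpos : (0 : ℝ) < m := by exact_mod_cast hm
  have hquad : ∀ p : EuclideanSpace ℂ (Fin n), (inner ℂ p (toEuclideanLin Y p)).re
      = 1 / m * ∑ i, truncWeight b i * ‖toEuclideanLin (measMatrix a) p i‖ ^ 2 := fun p => by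
    rw [hY, inner_initMatrix]
    have : (1 / (m : ℂ)) * ∑ i, (truncWeight b i : ℂ) *
        (conj (toEuclideanLin (measMatrix a) p i) * toEuclideanLin (measMatrix a) p i)
        = ((1 / m * ∑ i, truncWeight b i * ‖toEuclideanLin (measMatrix a) p i‖ ^ 2 : ℝ) : ℂ) := by
      push_cast
      congr 1
      exact Finset.sum_congr rfl fun i _ => by rw [Complex.conj_mul']
    rw [this, Complex.ofReal_re]
  have hμ : 3 / 2 ≤ μ := by
    have h1 := hray x
    rw [hquad, hx, one_pow, mul_one, one_div_mul_eq_div, div_le_iff₀ hmpos] at h1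
    have h2 := ha.rayleigh_self
    exact le_of_mul_le_mul_right (h2.trans h1) hmpos
  have hvv : (inner ℂ v (toEuclideanLin Y v)).re ≤ 6 / 5 * ‖v‖ ^ 2 := by
    rw [hquad, one_div_mul_eq_div, div_le_iff₀ hmpos]
    linarith [ha.rayleigh_orthogonal v hv]
  have hcross : (inner ℂ v (toEuclideanLin Y (α • x))).re ≤ κ * (‖α‖ * ‖v‖) := by
    -- `cross_le` bounds only a real part, without absolute value; testing it on a complex multiple
    -- of `v` absorbs the argument of `α`.
    have h1 := ha.cross_le (conj α • v) (by rw [inner_smul_right, hv, mul_zero])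
    have h2 : (inner ℂ v (toEuclideanLin Y (α • x))).re = 1 / m *
        ∑ i, ((truncWeight b i : ℂ) * conj (toEuclideanLin (measMatrix a) x i) *
          toEuclideanLin (measMatrix a) (conj α • v) i).re := by
      rw [hY, inner_initMatrix]
      have : (1 / (m : ℂ)) = ((1 / m : ℝ) : ℂ) := by push_cast; rfl
      rw [this, Complex.re_ofReal_mul, Complex.re_sum]
      congr 1
      refine Finset.sum_congr rfl fun i _ => ?_
      rw [← Complex.conj_re]
      congr 1
      simp
      ring
    rw [h2, one_div_mul_eq_div, div_le_iff₀ hmpos]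
    rw [norm_smul, RCLike.norm_conj] at h1
    linarith
  -- The eigenvalue equation paired with `v`. The gap `3 / 2 - 6 / 5 = 3 / 10` then bounds `‖v‖` by
  -- the cross term.
  have hkey : μ * ‖v‖ ^ 2 = (inner ℂ v (toEuclideanLin Y (α • x))).re
      + (inner ℂ v (toEuclideanLin Y v)).re := by
    have h1 : inner ℂ v (toEuclideanLin Y z) = ((μ * ‖v‖ ^ 2 : ℝ) : ℂ) := by
      have hvx : inner ℂ v x = 0 := by rw [← inner_conj_symm, hv, map_zero]
      rw [hYz, inner_smul_right, hdec, inner_add_right, inner_smul_right, hvx, mul_zero, zero_add,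
        inner_self_eq_norm_sq_to_K]
      push_cast
      rfl
    rw [← Complex.add_re, ← inner_add_right, ← map_add, ← hdec, h1, Complex.ofReal_re]
  have hmain : 3 / 10 * ‖v‖ ^ 2 ≤ κ * ‖α‖ * ‖v‖ := by
    nlinarith [sq_nonneg ‖v‖]
  have hbound : ‖v‖ ≠ 0 → ‖v‖ ≤ 10 / 3 * κ * ‖α‖ := fun h => by
    have : 0 < ‖v‖ := lt_of_le_of_ne (norm_nonneg _) (Ne.symm h)
    have : ‖v‖ * (3 / 10 * ‖v‖) ≤ ‖v‖ * (κ * ‖α‖) := by linarith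
    have := le_of_mul_le_mul_left this ‹0 < ‖v‖›
    linarith
  have hα : α ≠ 0 := by
    rintro rfl
    by_cases h0 : v = 0
    · exact hz0 (by rw [hdec, h0]; simp)
    · have h1 := hbound (norm_ne_zero_iff.2 h0)
      rw [norm_zero, mul_zero] at h1
      exact h0 (norm_le_zero_iff.1 h1)
  refine ⟨α, v, hα, hv, hdec, ?_⟩
  by_cases h0 : ‖v‖ = 0
  · rw [h0]; positivity
  · exact hbound h0

theorem measurements_smul (a : Fin m → EuclideanSpace ℂ (Fin n)) (x : EuclideanSpace ℂ (Fin n))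
    {r : ℝ} (hr : 0 ≤ r) :
    measurements a ((r : ℂ) • x) = fun i => r * measurements a x i := by
  funext i
  rw [measurements, measurements, map_smul, PiLp.smul_apply, norm_smul, Complex.norm_real,
    Real.norm_of_nonneg hr]

theorem initMatrix_const_mul (a : Fin m → EuclideanSpace ℂ (Fin n)) (b : Fin m → ℝ) {r : ℝ}
    (hr : 0 < r) : initMatrix a (fun i => r * b i) = ((r ^ 2 : ℝ) : ℂ) • initMatrix a b := by
  rw [initMatrix_eq, initMatrix_eq, smul_comm ((r ^ 2 : ℝ) : ℂ),
    Finset.smul_sum (r := ((r ^ 2 : ℝ) : ℂ))]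
  congr 1
  refine Finset.sum_congr rfl fun i _ => ?_
  rw [smul_smul, ← Complex.ofReal_mul]
  congr 2
  unfold truncWeight
  simp only [mul_pow, ← Finset.mul_sum]
  rw [mul_left_comm]
  simp only [mul_le_mul_iff_of_pos_left (pow_pos hr 2)]
  split_ifs <;> simp

theorem altProjStep_const_mul (A : Matrix (Fin m) (Fin n) ℂ) (b : Fin m → ℝ) (r : ℝ)
    (z : EuclideanSpace ℂ (Fin n)) :
    altProjStep A (fun i => r * b i) z = (r : ℂ) • altProjStep A b z := by
  unfold altProjStep
  rw [← map_smul]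
  congr 1
  ext i
  simp [mul_assoc]

theorem altProjStep_smul (A : Matrix (Fin m) (Fin n) ℂ) (b : Fin m → ℝ) {r : ℝ} (hr : 0 < r)
    (z : EuclideanSpace ℂ (Fin n)) :
    altProjStep A b ((r : ℂ) • z) = altProjStep A b z := by
  unfold altProjStep
  simp only [map_smul, PiLp.smul_apply, smul_eq_mul, phase_ofReal_mul hr]

/-- Projecting the error on `x` and on `v` gives `‖α‖ ≥ 99 / 100` and `‖v‖ ≤ s`. The rate `9 / 10`
leaves room in `7 / 8` for the division by `‖α‖`. -/
theorem GoodSensing.exists_norm_sub_altProjStep_le {β τ κ γ : ℝ}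
    {a : Fin m → EuclideanSpace ℂ (Fin n)} {x : EuclideanSpace ℂ (Fin n)}
    (hm : 0 < m) (hx : ‖x‖ = 1) (ha : GoodSensing β τ κ a x) (hτ : 0 < τ)
    (hγ : 800 * γ ^ 2 ≤ β * τ ^ 2) (hγ1 : γ ≤ 1 / 100) {s : ℝ} (hs : s ≤ 9 / 10 * γ)
    {u : ℂ} (hu : ‖u‖ = 1) {y : EuclideanSpace ℂ (Fin n)} (hy : ‖u • x - y‖ ≤ s) :
    ∃ u' : ℂ, ‖u'‖ = 1 ∧
      ‖u' • x - altProjStep (measMatrix a) (measurements a x) y‖ ≤ 9 / 10 * s := by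
  obtain ⟨α, v, hv, hdec⟩ := exists_orthogonal_decomposition hx y
  have hs0 : 0 ≤ s := (norm_nonneg _).trans hy
  have hxx : inner ℂ x x = (1 : ℂ) := by rw [inner_self_eq_norm_sq_to_K, hx]; simp
  have hvx : inner ℂ v x = 0 := by rw [← inner_conj_symm, hv, map_zero]
  have h1 : ‖u - α‖ ≤ s := by
    have e : inner ℂ x (u • x - y) = u - α := by
      rw [hdec, inner_sub_right, inner_add_right, inner_smul_right, inner_smul_right, hv, hxx]
      ring
    rw [← e]
    refine (norm_inner_le_norm x _).trans ?_
    rw [hx, one_mul]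
    exact hy
  have h2 : ‖v‖ ≤ s := by
    have e : inner ℂ v (u • x - y) = -((‖v‖ ^ 2 : ℝ) : ℂ) := by
      rw [hdec, inner_sub_right, inner_add_right, inner_smul_right, inner_smul_right, hvx,
        inner_self_eq_norm_sq_to_K]
      simp
    have h3 := norm_inner_le_norm (𝕜 := ℂ) v (u • x - y)
    rw [e, norm_neg, Complex.norm_real, Real.norm_of_nonneg (by positivity)] at h3
    by_cases h0 : ‖v‖ = 0
    · rw [h0]; exact hs0
    · have hpos : 0 < ‖v‖ := lt_of_le_of_ne (norm_nonneg _) (Ne.symm h0)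
      have h4 : ‖v‖ * ‖v‖ ≤ ‖v‖ * ‖u • x - y‖ := by rw [← sq]; exact h3
      exact (le_of_mul_le_mul_left h4 hpos).trans hy
  have h3 : 99 / 100 ≤ ‖α‖ := by
    have := norm_sub_norm_le u α
    rw [hu] at this
    linarith
  have hα : α ≠ 0 := norm_pos_iff.1 (by linarith)
  refine ⟨phase α, norm_phase α, ?_⟩
  rw [hdec]
  refine (ha.norm_sub_altProjStep_le hm hτ hγ hα hv ?_).trans ?_
  · nlinarith
  · rw [mul_div_assoc', div_le_iff₀ (by linarith)]
    nlinarith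

/-- Linear convergence of alternating projections with truncated spectral initialization, for
sensing vectors with the properties listed in `GoodSensing`. -/
theorem GoodSensing.iInf_norm_sub_le {β τ κ γ : ℝ}
    {a : Fin m → EuclideanSpace ℂ (Fin n)} {x : EuclideanSpace ℂ (Fin n)}
    (hm : 0 < m) (hx : ‖x‖ = 1) (ha : GoodSensing β τ κ a x) (hτ : 0 < τ) (hκ : 0 ≤ κ)
    (hκγ : 10 / 3 * κ ≤ γ) (hγ : 800 * γ ^ 2 ≤ β * τ ^ 2) (hγ1 : γ ≤ 1 / 100) {r : ℝ} (hr : 0 < r)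
    {z : ℕ → EuclideanSpace ℂ (Fin n)}
    (hz : IsAltProjRun a (measurements a ((r : ℂ) • x)) z) {t : ℕ} (ht : 1 ≤ t) :
    ⨅ φ : ℝ, ‖Complex.exp ((φ : ℂ) * Complex.I) • ((r : ℂ) • x) - z t‖
      ≤ (9 / 10) ^ t * ‖(r : ℂ) • x‖ := by
  have hγ0 : 0 ≤ γ := by linarith
  have hstep : ∀ t, z (t + 1) = (r : ℂ) • altProjStep (measMatrix a) (measurements a x) (z t) :=
    fun t => by rw [hz.step, measurements_smul a x hr.le, altProjStep_const_mul]
  -- The induction starts at `z 1`: the eigenvector `z 0` has arbitrary norm, so only its direction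
  -- is near that of the signal, and its ratio `‖v‖ / ‖α‖` is what the first step uses.
  have hmain : ∀ t : ℕ, ∃ (u : ℂ) (y : EuclideanSpace ℂ (Fin n)), ‖u‖ = 1 ∧
      z (t + 1) = (r : ℂ) • y ∧ ‖u • x - y‖ ≤ (9 / 10) ^ (t + 1) * γ := by
    intro t
    induction t with
    | zero =>
      have h0 := hz.init
      rw [measurements_smul a x hr.le, initMatrix_const_mul a _ hr] at h0
      obtain ⟨α, v, hα, hv, hdec, hle⟩ :=
        ha.exists_decomposition_of_isMainEigenvector hm hκ hx (h0.of_smul (by positivity))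
      have hle' : ‖v‖ ≤ γ * ‖α‖ := hle.trans (by gcongr)
      refine ⟨phase α, _, norm_phase α, hstep 0, ?_⟩
      rw [hdec]
      refine (ha.norm_sub_altProjStep_le hm hτ hγ hα hv hle').trans ?_
      have : ‖v‖ / ‖α‖ ≤ γ := (div_le_iff₀ (norm_pos_iff.2 hα)).2 hle'
      linarith
    | succ t ih =>
      obtain ⟨u, y, hu, hy, hle⟩ := ih
      have hp : (9 / 10 : ℝ) ^ (t + 1) ≤ 9 / 10 :=
        pow_le_of_le_one (by norm_num) (by norm_num) (by simp)
      obtain ⟨u', hu', hle'⟩ := ha.exists_norm_sub_altProjStep_le hm hx hτ hγ hγ1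
        (mul_le_mul_of_nonneg_right hp hγ0) hu hle
      refine ⟨u', _, hu', by rw [hstep, hy, altProjStep_smul _ _ hr], hle'.trans (le_of_eq ?_)⟩
      ring
  obtain ⟨t, rfl⟩ := Nat.exists_eq_add_of_le' ht
  obtain ⟨u, y, hu, hy, hle⟩ := hmain t
  obtain ⟨φ, hφ⟩ := exists_exp_eq_of_norm_eq_one hu
  refine (ciInf_le ⟨0, by rintro _ ⟨φ, rfl⟩; exact norm_nonneg _⟩ φ).trans ?_
  rw [hφ, hy, smul_comm, ← smul_sub, norm_smul, norm_smul, hx, Complex.norm_real,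
    Real.norm_of_nonneg hr.le, mul_one, mul_comm]
  refine mul_le_mul_of_nonneg_right (hle.trans ?_) hr.le
  have : (0 : ℝ) ≤ (9 / 10) ^ (t + 1) := by positivity
  nlinarith

end Deterministic

/-! ### Nets on the sphere and extension of bounds from a net. -/

section Nets

variable {E : Type*} [NormedAddCommGroup E] [NormedSpace ℝ E] [FiniteDimensional ℝ E]

/-- A separated subset of the unit sphere has at most exponentially many points. -/
theorem card_le_of_separated {s : Finset E} {ε : ℝ} (hε : 0 < ε) (hε1 : ε ≤ 1)
    (hs : ∀ c ∈ s, ‖c‖ = 1) (h : ∀ c ∈ s, ∀ d ∈ s, c ≠ d → ε ≤ ‖c - d‖) :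
    (s.card : ℝ) ≤ (3 / ε) ^ Module.finrank ℝ E := by
  borelize E
  let μ : Measure E := Measure.addHaar
  have hD : Set.PairwiseDisjoint (s : Set E) fun c => Metric.ball (c : E) (ε / 2) := by
    rintro c hc d hd hcd
    apply Metric.ball_disjoint_ball
    rw [dist_eq_norm]
    have := h c hc d hd hcd
    linarith
  -- Volume comparison: disjoint balls of radius `ε / 2` inside a ball of radius `3 / 2`.
  have hsub : (⋃ c ∈ s, Metric.ball (c : E) (ε / 2)) ⊆ Metric.ball (0 : E) (3 / 2) := by
    refine Set.iUnion₂_subset fun x hx => Metric.ball_subset_ball' ?_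
    rw [dist_zero_right, hs x hx]
    linarith
  have I : (s.card : ENNReal) * ENNReal.ofReal ((ε / 2) ^ Module.finrank ℝ E)
        * μ (Metric.ball 0 1)
      ≤ ENNReal.ofReal ((3 / 2) ^ Module.finrank ℝ E) * μ (Metric.ball 0 1) :=
    calc _ = μ (⋃ c ∈ s, Metric.ball (c : E) (ε / 2)) := by
          rw [measure_biUnion_finset hD fun c _ => measurableSet_ball]
          simp only [μ.addHaar_ball_of_pos _ (half_pos hε), Finset.sum_const, nsmul_eq_mul,
            mul_assoc]
      _ ≤ μ (Metric.ball (0 : E) (3 / 2)) := measure_mono hsub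
      _ = _ := by rw [μ.addHaar_ball_of_pos _ (by norm_num)]
  have J := (ENNReal.mul_le_mul_iff_left
    (Metric.measure_ball_pos _ _ zero_lt_one).ne' measure_ball_lt_top.ne).1 I
  have K := ENNReal.toReal_le_of_le_ofReal (by positivity) J
  rw [ENNReal.toReal_mul, ENNReal.toReal_natCast, ENNReal.toReal_ofReal (by positivity),
    ← le_div_iff₀ (by positivity), ← div_pow] at K
  have e : 3 / ε = 3 / 2 / (ε / 2) := by field_simp
  rw [e]
  exact K

/-- A separated subset of maximal cardinality is a net. Its points lie in `s`, so a net of the unit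
vectors orthogonal to `x` keeps the independence from the measurements of `x`. -/
theorem exists_net {s : Set E} (hs : ∀ v ∈ s, ‖v‖ = 1) {ε : ℝ} (hε : 0 < ε) (hε1 : ε ≤ 1) :
    ∃ N : Finset E, (N : Set E) ⊆ s ∧ (N.card : ℝ) ≤ (3 / ε) ^ Module.finrank ℝ E ∧
      ∀ v ∈ s, ∃ u ∈ N, ‖v - u‖ ≤ ε := by
  classical
  let sep : Finset E → Prop := fun N => (N : Set E) ⊆ s ∧
    ∀ c ∈ N, ∀ d ∈ N, c ≠ d → ε ≤ ‖c - d‖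
  have hsep : ∀ N, sep N → (N.card : ℝ) ≤ (3 / ε) ^ Module.finrank ℝ E := fun N hN =>
    card_le_of_separated hε hε1 (fun c hc => hs c (hN.1 hc)) hN.2
  have hbdd : BddAbove {k : ℕ | ∃ N, sep N ∧ N.card = k} := by
    refine ⟨⌊(3 / ε) ^ Module.finrank ℝ E⌋₊, ?_⟩
    rintro _ ⟨N, hN, rfl⟩
    exact Nat.le_floor (hsep N hN)
  obtain ⟨N, hN, hcard⟩ := Nat.sSup_mem (s := {k : ℕ | ∃ N, sep N ∧ N.card = k})
    ⟨0, ∅, ⟨by simp, by simp⟩, rfl⟩ hbdd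
  refine ⟨N, hN.1, hsep N hN, fun v hv => ?_⟩
  by_contra! hfar
  have hvN : v ∉ N := fun hvN => by
    have := hfar v hvN
    rw [sub_self, norm_zero] at this
    linarith
  have hins : sep (insert v N) := by
    refine ⟨by rw [Finset.coe_insert]; exact Set.insert_subset hv hN.1, ?_⟩
    intro c hc d hd hcd
    rcases Finset.mem_insert.1 hc with rfl | hc' <;> rcases Finset.mem_insert.1 hd with rfl | hd'
    · exact (hcd rfl).elim
    · exact (hfar d hd').le
    · rw [norm_sub_rev]; exact (hfar c hc').le
    · exact hN.2 c hc' d hd' hcd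
  have := le_csSup hbdd ⟨_, hins, rfl⟩
  rw [Finset.card_insert_of_notMem hvN, hcard] at this
  omega

omit [FiniteDimensional ℝ E] in
/-- A bound on a net extends to the whole cone, for a positively homogeneous Lipschitz function. -/
theorem le_of_net {f : E → ℝ} {s : Set E} {N : Finset E} {ε R L : ℝ} (hL : 0 ≤ L)
    (hs : ∀ v ∈ s, ∀ c : ℝ, c • v ∈ s) (hf : ∀ (c : ℝ) v, 0 < c → f (c • v) = c * f v)
    (hfL : ∀ u v, f v ≤ f u + L * ‖v - u‖) (hN : ∀ v ∈ s, ‖v‖ = 1 → ∃ u ∈ N, ‖v - u‖ ≤ ε)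
    (hR : ∀ u ∈ N, f u ≤ R) {v : E} (hv : v ∈ s) (h0 : v ≠ 0) : f v ≤ (R + L * ε) * ‖v‖ := by
  have hpos : 0 < ‖v‖ := norm_pos_iff.2 h0
  obtain ⟨u, hu, huv⟩ := hN _ (hs v hv ‖v‖⁻¹)
    (by rw [norm_smul, norm_inv, norm_norm, inv_mul_cancel₀ hpos.ne'])
  have h1 : f (‖v‖⁻¹ • v) ≤ R + L * ε :=
    (hfL u _).trans (add_le_add (hR u hu) (by gcongr))
  rw [hf _ _ (inv_pos.2 hpos), inv_mul_le_iff₀ hpos] at h1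
  linarith

variable {F : Type*} [NormedAddCommGroup F] [NormedSpace ℝ F]

omit [FiniteDimensional ℝ E] in
theorem norm_le_of_net {T : E →ₗ[ℝ] F} {s : Set E}
    (hs : ∀ v ∈ s, ∀ c : ℝ, c • v ∈ s) {N : Finset E} {ε R L : ℝ} (hL0 : 0 ≤ L)
    (hN : ∀ v ∈ s, ‖v‖ = 1 → ∃ u ∈ N, ‖v - u‖ ≤ ε) (hR : ∀ u ∈ N, ‖T u‖ ≤ R)
    (hL : ∀ v, ‖T v‖ ≤ L * ‖v‖) {v : E} (hv : v ∈ s) : ‖T v‖ ≤ (R + L * ε) * ‖v‖ := by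
  by_cases h0 : v = 0
  · simp [h0]
  refine le_of_net (f := fun v => ‖T v‖) hL0 hs (fun c v hc => ?_) (fun u v => ?_) hN hR hv h0
  · simp only [map_smul, norm_smul, Real.norm_of_nonneg hc.le]
  · have h1 := norm_sub_norm_le (T v) (T u)
    rw [← map_sub] at h1
    linarith [hL (v - u)]

/-- The operator norm `C` serves as its own Lipschitz constant: `C ≤ R + C * ε` can be solved for
`C`. -/
theorem norm_le_three_halves_mul_of_net {T : E →ₗ[ℝ] F} {N : Finset E} {ε R : ℝ} (hε : ε ≤ 1 / 4)
    (hR0 : 0 ≤ R) (hN : ∀ v : E, ‖v‖ = 1 → ∃ u ∈ N, ‖v - u‖ ≤ ε) (hR : ∀ u ∈ N, ‖T u‖ ≤ R)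
    (v : E) : ‖T v‖ ≤ 3 / 2 * R * ‖v‖ := by
  set C := ‖LinearMap.toContinuousLinearMap T‖ with hC
  have hTC : ∀ v, ‖T v‖ ≤ C * ‖v‖ := fun v => (LinearMap.toContinuousLinearMap T).le_opNorm v
  have h1 : C ≤ max (R + C * ε) 0 :=
    ContinuousLinearMap.opNorm_le_bound _ (le_max_right _ _) fun v =>
      (norm_le_of_net (s := Set.univ) (by simp) (norm_nonneg _) (fun v _ => hN v) hR hTC
        (Set.mem_univ v)).trans (by gcongr; exact le_max_left _ _)
  have hC0 : 0 ≤ C := norm_nonneg _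
  have h2 : C ≤ 3 / 2 * R := by
    rcases le_max_iff.1 h1 with h | h
    · nlinarith
    · linarith
  exact (hTC v).trans (by gcongr)

end Nets

/-! ### From properties on nets to uniform properties. -/

section Uniform

variable {m n : ℕ}

theorem norm_toLp_real_le {p : Fin m → ℝ} {R : ℝ} (hR : 0 ≤ R) :
    ‖(WithLp.toLp 2 p : EuclideanSpace ℝ (Fin m))‖ ≤ R ↔ ∑ i, p i ^ 2 ≤ R ^ 2 := by
  rw [← abs_of_nonneg (norm_nonneg (WithLp.toLp 2 p : EuclideanSpace ℝ (Fin m))),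
    ← abs_of_nonneg hR, ← sq_le_sq, EuclideanSpace.norm_sq_eq, abs_of_nonneg hR]
  simp

theorem norm_toLp_complex_le {p : Fin m → ℂ} {R : ℝ} (hR : 0 ≤ R) :
    ‖(WithLp.toLp 2 p : EuclideanSpace ℂ (Fin m))‖ ≤ R ↔ ∑ i, ‖p i‖ ^ 2 ≤ R ^ 2 := by
  rw [← abs_of_nonneg (norm_nonneg (WithLp.toLp 2 p : EuclideanSpace ℂ (Fin m))),
    ← abs_of_nonneg hR, ← sq_le_sq, EuclideanSpace.norm_sq_eq, abs_of_nonneg hR]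

/-- Entrywise multiplication by `c` after the sensing operator, over the reals. -/
noncomputable def weightedMeas (a : Fin m → EuclideanSpace ℂ (Fin n)) (c : Fin m → ℂ) :
    EuclideanSpace ℂ (Fin n) →ₗ[ℝ] EuclideanSpace ℂ (Fin m) where
  toFun v := WithLp.toLp 2 fun i => c i * toEuclideanLin (measMatrix a) v i
  map_add' u v := by ext i; simp [mul_add]
  map_smul' r v := by
    ext i
    have : r • v = (r : ℂ) • v := by ext j; simp
    rw [this, map_smul]
    simp [mul_left_comm]

/-- The imaginary parts of the entrywise product of `c` with the measurements. -/
noncomputable def imMeas (a : Fin m → EuclideanSpace ℂ (Fin n)) (c : Fin m → ℂ) :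
    EuclideanSpace ℂ (Fin n) →ₗ[ℝ] EuclideanSpace ℝ (Fin m) where
  toFun v := WithLp.toLp 2 fun i => (c i * toEuclideanLin (measMatrix a) v i).im
  map_add' u v := by ext i; simp [mul_add]
  map_smul' r v := by
    ext i
    have : r • v = (r : ℂ) • v := by ext j; simp
    rw [this, map_smul]
    simp
    ring

/-- The real part of the scalar product of `c` with the measurements. -/
noncomputable def reMeas (a : Fin m → EuclideanSpace ℂ (Fin n)) (c : Fin m → ℂ) :
    EuclideanSpace ℂ (Fin n) →ₗ[ℝ] ℝ where
  toFun v := ∑ i, (c i * toEuclideanLin (measMatrix a) v i).re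
  map_add' u v := by simp [mul_add, Finset.sum_add_distrib]
  map_smul' r v := by
    have : r • v = (r : ℂ) • v := by ext j; simp
    rw [this, map_smul]
    simp only [PiLp.smul_apply, smul_eq_mul, RingHom.id_apply, Finset.mul_sum]
    refine Finset.sum_congr rfl fun i _ => ?_
    rw [mul_left_comm, Complex.re_ofReal_mul]

theorem norm_weightedMeas_le (a : Fin m → EuclideanSpace ℂ (Fin n)) {c : Fin m → ℂ} {C : ℝ}
    (hC : 0 ≤ C) (hc : ∀ i, ‖c i‖ ≤ C) (v : EuclideanSpace ℂ (Fin n)) :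
    ‖weightedMeas a c v‖ ≤ C * ‖toEuclideanLin (measMatrix a) v‖ := by
  refine (norm_toLp_complex_le (by positivity)).2 ?_
  rw [mul_pow, EuclideanSpace.norm_sq_eq, Finset.mul_sum]
  refine Finset.sum_le_sum fun i _ => ?_
  rw [norm_mul, mul_pow]
  gcongr
  exact hc i

theorem norm_imMeas_le (a : Fin m → EuclideanSpace ℂ (Fin n)) (c : Fin m → ℂ)
    (v : EuclideanSpace ℂ (Fin n)) : ‖imMeas a c v‖ ≤ ‖weightedMeas a c v‖ := by
  refine (norm_toLp_real_le (norm_nonneg _)).2 ?_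
  rw [EuclideanSpace.norm_sq_eq]
  refine Finset.sum_le_sum fun i _ => ?_
  rw [← sq_abs]
  gcongr
  exact Complex.abs_im_le_norm _

theorem abs_reMeas_le (a : Fin m → EuclideanSpace ℂ (Fin n)) (c : Fin m → ℂ)
    (v : EuclideanSpace ℂ (Fin n)) :
    |reMeas a c v| ≤ √(∑ i, ‖c i‖ ^ 2) * ‖toEuclideanLin (measMatrix a) v‖ := by
  change |∑ i, (c i * toEuclideanLin (measMatrix a) v i).re| ≤ _
  rw [EuclideanSpace.norm_eq]
  refine le_trans ?_ (Real.sum_mul_le_sqrt_mul_sqrt _ _ _)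
  refine (Finset.abs_sum_le_sum_abs _ _).trans (Finset.sum_le_sum fun i _ => ?_)
  exact (Complex.abs_re_le_norm _).trans (norm_mul _ _).le

/-- The properties in `GoodSensing` follow from slightly stronger ones on nets. -/
theorem GoodSensing.of_net {a : Fin m → EuclideanSpace ℂ (Fin n)} {x : EuclideanSpace ℂ (Fin n)}
    (hm : 0 < m) {N N' : Finset (EuclideanSpace ℂ (Fin n))}
    (hN : ∀ v : EuclideanSpace ℂ (Fin n), ‖v‖ = 1 → ∃ u ∈ N, ‖v - u‖ ≤ 1 / 10 ^ 14)
    (hN' : ∀ v : EuclideanSpace ℂ (Fin n), inner ℂ x v = 0 → ‖v‖ = 1 →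
      ∃ u ∈ N', ‖v - u‖ ≤ 1 / 10 ^ 14)
    (hupper : ∀ u ∈ N, ∑ i, ‖toEuclideanLin (measMatrix a) u i‖ ^ 2 ≤ (1 + 3 / 100) * m)
    (hlower : ∀ u ∈ N, (1 - 3 / 100 : ℝ) * m ≤ ∑ i, ‖toEuclideanLin (measMatrix a) u i‖ ^ 2)
    (hexcess : ∀ u ∈ N, ∑ i, max (‖toEuclideanLin (measMatrix a) u i‖ ^ 2 - (80 : ℝ)) 0
      ≤ 1 / 10 ^ 7 * (m : ℝ))
    (him : ∀ u ∈ N', ∑ i, (conj (phase (toEuclideanLin (measMatrix a) x i)) *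
      toEuclideanLin (measMatrix a) u i).im ^ 2 ≤ (1 / 2 + 1 / 100) * m)
    (hsmall : ∑ i, (if ‖toEuclideanLin (measMatrix a) x i‖ < 7 / 10 ^ 6 then (1 : ℝ) else 0)
      ≤ 1 / 10 ^ 9 / 2 * m)
    (htrunc : 3 / 2 * m ≤ ∑ i, if ‖toEuclideanLin (measMatrix a) x i‖ ^ 2 ≤ 8 then
      ‖toEuclideanLin (measMatrix a) x i‖ ^ 4 else 0)
    (hx1 : ∑ i, ‖toEuclideanLin (measMatrix a) x i‖ ^ 2 ≤ (1 + 1 / 10) * m)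
    (hx2 : (1 - 1 / 10 : ℝ) * m ≤ ∑ i, ‖toEuclideanLin (measMatrix a) x i‖ ^ 2)
    (hweight : ∀ u ∈ N', ∑ i, truncWeight (measurements a x) i *
      ‖toEuclideanLin (measMatrix a) u i‖ ^ 2 ≤ 23 / 20 * m)
    (hcross : ∀ u ∈ N', ∑ i, ((truncWeight (measurements a x) i : ℂ) *
      conj (toEuclideanLin (measMatrix a) x i) * toEuclideanLin (measMatrix a) u i).re
        ≤ 1 / 10 ^ 12 * m) :
    GoodSensing (1 / 10 ^ 9) (7 / 10 ^ 6) (2 / 10 ^ 12) a x := by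
  have hmpos : (0 : ℝ) < m := by exact_mod_cast hm
  have hs : 0 < √(m : ℝ) := Real.sqrt_pos.2 hmpos
  have hs2 : √(m : ℝ) ^ 2 = m := Real.sq_sqrt hmpos.le
  have hperp : ∀ v ∈ {v : EuclideanSpace ℂ (Fin n) | inner ℂ x v = 0}, ∀ c : ℝ,
      c • v ∈ {v : EuclideanSpace ℂ (Fin n) | inner ℂ x v = 0} := fun v hv c => by
    have : c • v = (c : ℂ) • v := by ext j; simp
    rw [Set.mem_ofPred_eq, this, inner_smul_right, hv, mul_zero]
  set A := measMatrix a with hA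
  set g := toEuclideanLin A x with hg
  set w := truncWeight (measurements a x) with hw
  have hb : measurements a x = fun i => ‖g i‖ := rfl
  have hupper' : ∀ v, ‖toEuclideanLin A v‖ ≤ 2 * √m * ‖v‖ := fun v => by
    have h1 := norm_le_three_halves_mul_of_net (T := (toEuclideanLin A).restrictScalars ℝ)
      (R := 51 / 50 * √m) (by norm_num) (by positivity) hN (fun u hu => by
        refine abs_le_of_sq_le_sq' ?_ (by positivity) |>.2
        rw [LinearMap.restrictScalars_apply, EuclideanSpace.norm_sq_eq, mul_pow, hs2]
        linarith [hupper u hu]) v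
    refine h1.trans ?_
    have : 0 ≤ √(m : ℝ) * ‖v‖ := by positivity
    linarith
  have hw0 : ∀ i, 0 ≤ w i := truncWeight_nonneg _
  have hw10 : ∀ i, w i ≤ 10 := truncWeight_le_ten hm (b := measurements a x) hx1
  have hL : ∀ (c : Fin m → ℂ) (C : ℝ), 0 ≤ C → (∀ i, ‖c i‖ ≤ C) → ∀ v,
      ‖weightedMeas a c v‖ ≤ C * (2 * √m) * ‖v‖ := fun c C hC hc v => by
    refine (norm_weightedMeas_le a hC hc v).trans ?_
    rw [mul_assoc]
    gcongr
    exact hupper' v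
  refine ⟨fun v => ?_, hupper', fun v hv => ?_, fun S hS v => ?_, hsmall, ?_, fun v hv => ?_,
    fun v hv => ?_⟩
  · by_cases h0 : v = 0
    · simp [h0]
    have h1 := le_of_net (f := fun v => -‖toEuclideanLin A v‖) (s := Set.univ) (N := N)
      (ε := 1 / 10 ^ 14) (R := -(49 / 50 * √m)) (L := 2 * √m) (by positivity) (by simp)
      (fun c v hc => by
        have : c • v = (c : ℂ) • v := by ext j; simp
        rw [this, map_smul, norm_smul, Complex.norm_real, Real.norm_of_nonneg hc.le]
        ring) (fun u v => by
        have h1 := norm_sub_norm_le (toEuclideanLin A u) (toEuclideanLin A v)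
        rw [← map_sub] at h1
        have h2 := hupper' (u - v)
        rw [norm_sub_rev u v] at h2
        linarith) (fun v _ => hN v) (fun u hu => by
        refine neg_le_neg (abs_le_of_sq_le_sq' ?_ (norm_nonneg _) |>.2)
        rw [EuclideanSpace.norm_sq_eq, mul_pow, hs2]
        linarith [hlower u hu]) (Set.mem_univ v) h0
    have : 0 ≤ √(m : ℝ) * ‖v‖ := by positivity
    nlinarith
  · refine (norm_toLp_real_le (by positivity)).1 (show ‖imMeas a (fun i => conj (phase (g i))) v‖
      ≤ 18 / 25 * √m * ‖v‖ from ?_)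
    have h1 := norm_le_of_net (T := imMeas a (fun i => conj (phase (g i)))) hperp
      (R := 143 / 200 * √m) (L := 1 * (2 * √m)) (by positivity) hN' (fun u hu => by
        refine (norm_toLp_real_le (by positivity)).2 ?_
        rw [mul_pow, hs2]
        linarith [him u hu]) (fun v => (norm_imMeas_le a _ v).trans
          (hL _ 1 zero_le_one (fun i => by rw [RCLike.norm_conj, norm_phase]) v)) hv
    have : 0 ≤ √(m : ℝ) * ‖v‖ := by positivity
    nlinarith
  · classical
    have key : ∀ v, ∑ i, ‖(if i ∈ S then (1 : ℂ) else 0) * toEuclideanLin A v i‖ ^ 2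
        = ∑ i ∈ S, ‖toEuclideanLin A v i‖ ^ 2 := fun v => by
      rw [← Finset.sum_filter_add_sum_filter_not Finset.univ (· ∈ S)]
      simp only [Finset.filter_mem_eq_inter, Finset.univ_inter]
      rw [Finset.sum_congr (g := fun i => ‖toEuclideanLin A v i‖ ^ 2) rfl
        fun i hi => by rw [if_pos hi, one_mul]]
      rw [Finset.sum_eq_zero (s := Finset.univ.filter (· ∉ S))
        fun i hi => by rw [if_neg (Finset.mem_filter.1 hi).2]; simp]
      rw [add_zero]
    rw [← key]
    refine (norm_toLp_complex_le (by positivity)).1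
      (show ‖weightedMeas a (fun i => if i ∈ S then (1 : ℂ) else 0) v‖ ≤ _ from ?_)
    -- On `S` the energy is at most `80` per coordinate plus the total excess: `80 / 10 ^ 9 + 1 / 10
    -- ^ 7 ≤ (1 / 2000) ^ 2`.
    have h1 := norm_le_of_net (T := weightedMeas a (fun i => if i ∈ S then (1 : ℂ) else 0))
      (s := Set.univ) (by simp)
      (R := 1 / 2000 * √m) (L := 1 * (2 * √m)) (by positivity) (fun v _ => hN v) (fun u hu => by
        refine (norm_toLp_complex_le (by positivity)).2 ?_
        rw [key, mul_pow, hs2]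
        have h2 : ∑ i ∈ S, ‖toEuclideanLin A u i‖ ^ 2
            ≤ ∑ i ∈ S, (80 + max (‖toEuclideanLin A u i‖ ^ 2 - 80) 0) :=
          Finset.sum_le_sum fun i _ => by
            linarith [le_max_left (‖toEuclideanLin A u i‖ ^ 2 - 80) 0]
        have h3 : ∑ i ∈ S, max (‖toEuclideanLin A u i‖ ^ 2 - 80) 0
            ≤ ∑ i, max (‖toEuclideanLin A u i‖ ^ 2 - 80) 0 :=
          Finset.sum_le_sum_of_subset_of_nonneg (Finset.subset_univ _)
            fun i _ _ => le_max_right _ _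
        rw [Finset.sum_add_distrib, Finset.sum_const, nsmul_eq_mul] at h2
        have := hexcess u hu
        linarith) (hL _ 1 zero_le_one (fun i => by split_ifs <;> simp)) (Set.mem_univ v)
    have : 0 ≤ √(m : ℝ) * ‖v‖ := by positivity
    nlinarith
  · refine htrunc.trans (Finset.sum_le_sum fun i _ => ?_)
    split_ifs with h
    · change _ ≤ w i * ‖g i‖ ^ 2
      rw [hw, truncWeight, hb, if_pos]
      · exact le_of_eq (by ring)
      -- The random threshold is at least `9 * (9 / 10) > 8`, so the truncation at `8` is the
      -- stricter one.
      · refine h.trans ?_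
        rw [div_mul_eq_mul_div, le_div_iff₀ hmpos]
        linarith
    · exact mul_nonneg (hw0 i) (by positivity)
  · have key : ∀ v, ∑ i, ‖(√(w i) : ℂ) * toEuclideanLin A v i‖ ^ 2
        = ∑ i, w i * ‖toEuclideanLin A v i‖ ^ 2 := fun v => by
      refine Finset.sum_congr rfl fun i _ => ?_
      rw [norm_mul, mul_pow, Complex.norm_real, Real.norm_of_nonneg (Real.sqrt_nonneg _),
        Real.sq_sqrt (hw0 i)]
    have h1 := norm_le_of_net (T := weightedMeas a (fun i => (√(w i) : ℂ))) hperp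
      (R := 27 / 25 * √m) (L := 4 * (2 * √m)) (by positivity) hN' (fun u hu => by
        refine (norm_toLp_complex_le (by positivity)).2 ?_
        rw [key, mul_pow, hs2]
        linarith [hweight u hu]) (hL _ 4 (by norm_num) (fun i => by
          rw [Complex.norm_real, Real.norm_of_nonneg (Real.sqrt_nonneg _), Real.sqrt_le_iff]
          constructor <;> linarith [hw10 i])) hv
    have h2 : ‖weightedMeas a (fun i => (√(w i) : ℂ)) v‖ ≤ 109 / 100 * √m * ‖v‖ := by
      have : 0 ≤ √(m : ℝ) * ‖v‖ := by positivity
      nlinarith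
    have h3 := (norm_toLp_complex_le (by positivity)).1 h2
    rw [key, mul_pow, mul_pow, hs2] at h3
    have : 0 ≤ (m : ℝ) * ‖v‖ ^ 2 := by positivity
    linarith
  · by_cases h0 : v = 0
    · simp [h0]
    set c : Fin m → ℂ := fun i => (w i : ℂ) * conj (g i) with hc
    have hcsum : √(∑ i, ‖c i‖ ^ 2) ≤ 11 * √m := by
      rw [Real.sqrt_le_iff]
      refine ⟨by positivity, ?_⟩
      rw [mul_pow, hs2]
      have h1 : ∑ i, ‖c i‖ ^ 2 ≤ ∑ i, 100 * ‖g i‖ ^ 2 := by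
        refine Finset.sum_le_sum fun i _ => ?_
        rw [hc, norm_mul, mul_pow, RCLike.norm_conj, Complex.norm_real,
          Real.norm_of_nonneg (hw0 i)]
        gcongr
        nlinarith [hw0 i, hw10 i]
      rw [← Finset.mul_sum] at h1
      linarith
    have hLip : ∀ v, |reMeas a c v| ≤ 22 * m * ‖v‖ := fun v => by
      refine (abs_reMeas_le a c v).trans ?_
      calc _ ≤ 11 * √m * (2 * √m * ‖v‖) := by
            gcongr
            exact hupper' v
        _ = 22 * √m ^ 2 * ‖v‖ := by ring
        _ = _ := by rw [hs2]
    have h1 := le_of_net (f := fun v => reMeas a c v) (N := N')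
      (ε := 1 / 10 ^ 14) (R := 1 / 10 ^ 12 * m) (L := 22 * m) (by positivity) hperp
      (fun c v _ => by rw [map_smul, smul_eq_mul]) (fun u v => by
        have h1 := (abs_le.1 (hLip (v - u))).2
        rw [map_sub] at h1
        linarith) hN' hcross hv h0
    change reMeas a c v ≤ _
    have : 0 ≤ (m : ℝ) * ‖v‖ := by positivity
    nlinarith

end Uniform

/-! ### Gaussian sensing vectors are good with overwhelming probability. -/

section Probability

variable {Ω : Type*} [MeasurableSpace Ω] {P : Measure Ω} [IsProbabilityMeasure P] {m n : ℕ}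
  {a : Fin m → Ω → EuclideanSpace ℂ (Fin n)}

theorem IsGaussianSensing.measure_single_le (ha : IsGaussianSensing P a)
    {v : EuclideanSpace ℂ (Fin n)} (hv : ‖v‖ = 1) {s : Set (Fin m → ℂ)} {p : ENNReal}
    (h : gaussianVec m s ≤ p) :
    P {ω | (fun i => toEuclideanLin (measMatrix fun i => a i ω) v i) ∈ s} ≤ p := by
  have hl := ha.hasLaw_single hv
  have h1 := Measure.le_map_apply hl.aemeasurable s
  rw [hl.map_eq] at h1
  exact h1.trans h

/-- Fubini: by independence, the measurements of `x` may be frozen at any `g`. -/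
theorem IsGaussianSensing.measure_pair_le (ha : IsGaussianSensing P a)
    {x v : EuclideanSpace ℂ (Fin n)} (hx : ‖x‖ = 1) (hv : ‖v‖ = 1) (hxv : inner ℂ x v = 0)
    {s : Set ((Fin m → ℂ) × (Fin m → ℂ))} (hs : MeasurableSet s) {p : ENNReal}
    (h : ∀ g, gaussianVec m {y | (g, y) ∈ s} ≤ p) :
    P {ω | ((fun i => toEuclideanLin (measMatrix fun i => a i ω) x i),
      (fun i => toEuclideanLin (measMatrix fun i => a i ω) v i)) ∈ s} ≤ p := by
  have hl := ha.hasLaw_pair hx hv hxv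
  have h1 := Measure.le_map_apply hl.aemeasurable s
  rw [hl.map_eq, Measure.prod_apply hs] at h1
  refine h1.trans ((lintegral_mono h).trans ?_)
  rw [lintegral_const, measure_univ, mul_one]

omit [IsProbabilityMeasure P] in
theorem measure_exists_mem_le {E : Type*} {N : Finset E} {bad : E → Set Ω} {k : ℝ}
    (hN : (N.card : ℝ) ≤ Real.exp k)
    (h : ∀ u ∈ N, P (bad u) ≤ ENNReal.ofReal (Real.exp (-(2 * k)))) :
    P {ω | ∃ u ∈ N, ω ∈ bad u} ≤ ENNReal.ofReal (Real.exp (-k)) := by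
  have h1 : {ω | ∃ u ∈ N, ω ∈ bad u} = ⋃ u ∈ N, bad u := by ext; simp
  rw [h1]
  refine (measure_biUnion_finset_le N bad).trans ((Finset.sum_le_sum h).trans ?_)
  rw [Finset.sum_const, nsmul_eq_mul, ← ENNReal.ofReal_natCast,
    ← ENNReal.ofReal_mul (by positivity)]
  refine ENNReal.ofReal_le_ofReal ?_
  calc _ ≤ Real.exp k * Real.exp (-(2 * k)) := by gcongr
    _ = _ := by rw [← Real.exp_add]; ring_nf

theorem measurable_phase : Measurable phase :=
  Measurable.ite (measurableSet_singleton 0) measurable_const (by fun_prop)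

theorem measurable_truncWeight (i : Fin m) :
    Measurable fun g : Fin m → ℂ => truncWeight (fun j => ‖g j‖) i :=
  Measurable.ite (measurableSet_le (by fun_prop) (by fun_prop)) (by fun_prop) (by fun_prop)

theorem measurableSet_sum_norm_sq_fst_le (c : ℝ) :
    MeasurableSet {q : (Fin m → ℂ) × (Fin m → ℂ) | ∑ i, ‖q.1 i‖ ^ 2 ≤ c} :=
  measurableSet_le (by fun_prop) measurable_const

theorem ofReal_exp_neg_mul_le {c k : ℝ} (h : k ≤ c) :
    ENNReal.ofReal (Real.exp (-c * m)) ≤ ENNReal.ofReal (Real.exp (-(k * m))) := by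
  refine ENNReal.ofReal_le_ofReal (Real.exp_le_exp.2 ?_)
  rw [neg_mul]
  exact neg_le_neg (by gcongr)

theorem IsGaussianSensing.measure_im_le (ha : IsGaussianSensing P a)
    {x v : EuclideanSpace ℂ (Fin n)} (hx : ‖x‖ = 1) (hv : ‖v‖ = 1) (hxv : inner ℂ x v = 0) :
    P {ω | (1 / 2 + 1 / 100) * m ≤
      ∑ i, (conj (phase (toEuclideanLin (measMatrix fun i => a i ω) x i)) *
        toEuclideanLin (measMatrix fun i => a i ω) v i).im ^ 2}
      ≤ ENNReal.ofReal (Real.exp (-((1 / 100) ^ 2 / 4) * m)) := by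
  refine ha.measure_pair_le hx hv hxv (s := {q : (Fin m → ℂ) × (Fin m → ℂ) |
    (1 / 2 + 1 / 100) * (m : ℝ) ≤ ∑ i, (conj (phase (q.1 i)) * q.2 i).im ^ 2}) ?_ fun g => ?_
  · refine measurableSet_le measurable_const (Finset.measurable_sum _ fun i _ => ?_)
    have h1 : Measurable fun q : (Fin m → ℂ) × (Fin m → ℂ) => conj (phase (q.1 i)) :=
      Complex.continuous_conj.measurable.comp (measurable_phase.comp (by fun_prop))
    exact (Complex.measurable_im.comp (h1.mul (by fun_prop))).pow_const 2
  · exact gaussianVec_sum_im_sq_ge m (u := fun i => conj (phase (g i)))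
      (fun i => by rw [RCLike.norm_conj, norm_phase]) (by norm_num) (by norm_num)

/-- The event includes the bound on the energy of `A x` because the frozen weights are then at most
`10`, with sum at most `11 / 10 * m`. -/
theorem IsGaussianSensing.measure_weighted_le (hm : 0 < m) (ha : IsGaussianSensing P a)
    {x v : EuclideanSpace ℂ (Fin n)} (hx : ‖x‖ = 1) (hv : ‖v‖ = 1) (hxv : inner ℂ x v = 0) :
    P {ω | ∑ i, ‖toEuclideanLin (measMatrix fun i => a i ω) x i‖ ^ 2 ≤ (1 + 1 / 10) * m ∧
      23 / 20 * m ≤ ∑ i, truncWeight (measurements (fun i => a i ω) x) i *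
        ‖toEuclideanLin (measMatrix fun i => a i ω) v i‖ ^ 2}
      ≤ ENNReal.ofReal (Real.exp (-(1 / 50000) * m)) := by
  refine ha.measure_pair_le hx hv hxv (s := {q : (Fin m → ℂ) × (Fin m → ℂ) |
    ∑ i, ‖q.1 i‖ ^ 2 ≤ (1 + 1 / 10) * (m : ℝ) ∧
      23 / 20 * (m : ℝ) ≤ ∑ i, truncWeight (fun j => ‖q.1 j‖) i * ‖q.2 i‖ ^ 2}) ?_ fun g => ?_
  · refine (measurableSet_sum_norm_sq_fst_le _).inter (s₂ := {q : (Fin m → ℂ) × (Fin m → ℂ) |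
      23 / 20 * (m : ℝ) ≤ ∑ i, truncWeight (fun j => ‖q.1 j‖) i * ‖q.2 i‖ ^ 2})
      (measurableSet_le measurable_const (Finset.measurable_sum _ fun i _ => ?_))
    exact ((measurable_truncWeight i).comp measurable_fst).mul (by fun_prop)
  · by_cases hg : ∑ i, ‖g i‖ ^ 2 ≤ (1 + 1 / 10) * (m : ℝ)
    · refine le_trans (measure_mono fun y hy => hy.2)
        (gaussianVec_sum_weighted_ge m (w := truncWeight fun j => ‖g j‖) (truncWeight_nonneg _)
          (truncWeight_le_ten hm (b := fun j => ‖g j‖) hg) ?_)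
      refine (Finset.sum_le_sum fun i _ => truncWeight_le_sq (fun j => ‖g j‖) i).trans ?_
      linarith
    · exact (measure_mono (t := ∅) fun y hy => hg hy.1).trans (by simp)

theorem IsGaussianSensing.measure_cross_le (hm : 0 < m) (ha : IsGaussianSensing P a)
    {x v : EuclideanSpace ℂ (Fin n)} (hx : ‖x‖ = 1) (hv : ‖v‖ = 1) (hxv : inner ℂ x v = 0) :
    P {ω | ∑ i, ‖toEuclideanLin (measMatrix fun i => a i ω) x i‖ ^ 2 ≤ (1 + 1 / 10) * m ∧
      1 / 10 ^ 12 * m ≤ ∑ i, ((truncWeight (measurements (fun i => a i ω) x) i : ℂ) *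
        conj (toEuclideanLin (measMatrix fun i => a i ω) x i) *
          toEuclideanLin (measMatrix fun i => a i ω) v i).re}
      ≤ ENNReal.ofReal (Real.exp (-(7 / 10 ^ 27) * m)) := by
  refine ha.measure_pair_le hx hv hxv (s := {q : (Fin m → ℂ) × (Fin m → ℂ) |
    ∑ i, ‖q.1 i‖ ^ 2 ≤ (1 + 1 / 10) * (m : ℝ) ∧ 1 / 10 ^ 12 * (m : ℝ) ≤
      ∑ i, ((truncWeight (fun j => ‖q.1 j‖) i : ℂ) * conj (q.1 i) * q.2 i).re}) ?_ fun g => ?_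
  · refine (measurableSet_sum_norm_sq_fst_le _).inter (s₂ := {q : (Fin m → ℂ) × (Fin m → ℂ) |
      1 / 10 ^ 12 * (m : ℝ) ≤
        ∑ i, ((truncWeight (fun j => ‖q.1 j‖) i : ℂ) * conj (q.1 i) * q.2 i).re})
      (measurableSet_le measurable_const (Finset.measurable_sum _ fun i _ => ?_))
    have h1 : Measurable fun q : (Fin m → ℂ) × (Fin m → ℂ) =>
        (truncWeight (fun j => ‖q.1 j‖) i : ℂ) :=
      Complex.measurable_ofReal.comp ((measurable_truncWeight i).comp measurable_fst)
    exact Complex.measurable_re.comp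
      ((h1.mul (Complex.continuous_conj.measurable.comp (by fun_prop))).mul (by fun_prop))
  · by_cases hg : ∑ i, ‖g i‖ ^ 2 ≤ (1 + 1 / 10) * (m : ℝ)
    · refine le_trans (measure_mono fun y hy => hy.2)
        -- With coefficients of total energy at most `110 * m`, the parameter `1 / 10 ^ 14` gives an
        -- exponent below `-(7 / 10 ^ 27) * m`.
        ((gaussianVec_sum_re_ge m (fun i => (truncWeight (fun j => ‖g j‖) i : ℂ) * conj (g i))
          (1 / 10 ^ 14) (1 / 10 ^ 12 * m) (by norm_num)).trans
          (ENNReal.ofReal_le_ofReal (Real.exp_le_exp.2 ?_)))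
      have h1 : ∑ i, ‖(truncWeight (fun j => ‖g j‖) i : ℂ) * conj (g i)‖ ^ 2
          ≤ ∑ i, 100 * ‖g i‖ ^ 2 := by
        refine Finset.sum_le_sum fun i _ => ?_
        have h2 := truncWeight_nonneg (fun j => ‖g j‖) i
        have h3 := truncWeight_le_ten hm (b := fun j => ‖g j‖) hg i
        rw [norm_mul, mul_pow, RCLike.norm_conj, Complex.norm_real, Real.norm_of_nonneg h2]
        gcongr
        nlinarith
      rw [← Finset.mul_sum] at h1
      have : (0 : ℝ) ≤ m := by positivity
      linarith
    · exact (measure_mono (t := ∅) fun y hy => hg hy.1).trans (by simp)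

theorem exp_neg_forty_le : Real.exp (-(80 / 2)) ≤ 1 / 10 ^ 12 := by
  have h1 : (2 : ℝ) ≤ Real.exp 1 := by
    have := Real.add_one_le_exp (1 : ℝ)
    linarith
  have h2 : (10 : ℝ) ^ 12 ≤ Real.exp 40 := by
    have : Real.exp 40 = Real.exp 1 ^ 40 := by rw [← Real.exp_nat_mul]; norm_num
    rw [this]
    calc (10 : ℝ) ^ 12 ≤ 2 ^ 40 := by norm_num
      _ ≤ _ := by gcongr
  have h3 : (-(80 / 2) : ℝ) = -40 := by norm_num
  rw [h3, Real.exp_neg, ← one_div]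
  gcongr

/-- Gaussian sensing vectors have the properties in `GoodSensing`, with overwhelming
probability. -/
theorem IsGaussianSensing.measure_not_goodSensing_le (hm : 0 < m)
    (hmn : 6 * 10 ^ 41 * (n : ℝ) ≤ m) (ha : IsGaussianSensing P a)
    {x : EuclideanSpace ℂ (Fin n)} (hx : ‖x‖ = 1) :
    P {ω | ¬ GoodSensing (1 / 10 ^ 9) (7 / 10 ^ 6) (2 / 10 ^ 12) (fun i => a i ω) x}
      ≤ ENNReal.ofReal (10 * Real.exp (-(1 / 10 ^ 27 * m))) := by
  have hmpos : (0 : ℝ) < m := by exact_mod_cast hm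
  have hfin : Module.finrank ℝ (EuclideanSpace ℂ (Fin n)) = 2 * n := by
    rw [← Module.finrank_mul_finrank ℝ ℂ, Complex.finrank_real_complex, finrank_euclideanSpace_fin]
  have hcard : ∀ N : Finset (EuclideanSpace ℂ (Fin n)),
      (N.card : ℝ) ≤ (3 / (1 / 10 ^ 14)) ^ Module.finrank ℝ (EuclideanSpace ℂ (Fin n)) →
      (N.card : ℝ) ≤ Real.exp (1 / 10 ^ 27 * m) := fun N hN => by
    -- In real dimension `2 * n` this crude bound makes the net at most `exp (6 * 10 ^ 14 * n)`,
    -- which fixes `M = 6 * 10 ^ 41`.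
    have h1 : (3 / (1 / 10 ^ 14) : ℝ) ≤ Real.exp (3 * 10 ^ 14) := by
      have h2 := Real.add_one_le_exp (3 * 10 ^ 14 : ℝ)
      have h3 : (3 / (1 / 10 ^ 14) : ℝ) = 3 * 10 ^ 14 := by norm_num
      rw [h3]
      linarith
    refine hN.trans ((pow_le_pow_left₀ (by norm_num) h1 _).trans ?_)
    rw [← Real.exp_nat_mul, hfin]
    refine Real.exp_le_exp.2 ?_
    push_cast
    linarith
  obtain ⟨N, hNs, hNc, hN⟩ := exists_net (s := {v : EuclideanSpace ℂ (Fin n) | ‖v‖ = 1})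
    (fun v hv => hv) (ε := 1 / 10 ^ 14) (by norm_num) (by norm_num)
  obtain ⟨N', hNs', hNc', hN'⟩ := exists_net
    (s := {v : EuclideanSpace ℂ (Fin n) | inner ℂ x v = 0 ∧ ‖v‖ = 1})
    (fun v hv => hv.2) (ε := 1 / 10 ^ 14) (by norm_num) (by norm_num)
  set q := ENNReal.ofReal (Real.exp (-(1 / 10 ^ 27 * m))) with hq
  -- Events indexed by a net need twice the final rate, since the union bound consumes one half.
  have weaken : ∀ {c : ℝ}, 1 / 10 ^ 26 ≤ c → ENNReal.ofReal (Real.exp (-c * m)) ≤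
      ENNReal.ofReal (Real.exp (-(2 * (1 / 10 ^ 27 * m)))) := fun {c} hc => by
    refine (ofReal_exp_neg_mul_le (m := m) (k := 2 * (1 / 10 ^ 27)) (by linarith)).trans
      (le_of_eq ?_)
    rw [mul_assoc]
  have weaken' : ∀ {c : ℝ}, 1 / 10 ^ 26 ≤ c → ENNReal.ofReal (Real.exp (-c * m)) ≤ q :=
    fun {c} hc => ofReal_exp_neg_mul_le (m := m) (by linarith)
  let y : Ω → EuclideanSpace ℂ (Fin n) → EuclideanSpace ℂ (Fin m) := fun ω =>
    toEuclideanLin (measMatrix fun i => a i ω)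
  have b1 : P {ω | ∃ u ∈ N, ω ∈ {ω | (1 + 3 / 100) * (m : ℝ) ≤ ∑ i, ‖y ω u i‖ ^ 2}} ≤ q :=
    measure_exists_mem_le (hcard N hNc) fun u hu =>
      (ha.measure_single_le (hNs hu)
        (gaussianVec_sum_norm_sq_ge m (c := 3 / 100) (by norm_num) (by norm_num))).trans
        (weaken (by norm_num))
  have b2 : P {ω | ∃ u ∈ N, ω ∈ {ω | ∑ i, ‖y ω u i‖ ^ 2 ≤ (1 - 3 / 100) * (m : ℝ)}} ≤ q :=
    measure_exists_mem_le (hcard N hNc) fun u hu =>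
      (ha.measure_single_le (hNs hu)
        (gaussianVec_sum_norm_sq_le m (c := 3 / 100) (by norm_num))).trans
        (weaken (by norm_num))
  have b3 : P {ω | ∃ u ∈ N, ω ∈ {ω | 1 / 10 ^ 7 * (m : ℝ) ≤
      ∑ i, max (‖y ω u i‖ ^ 2 - (80 : ℝ)) 0}} ≤ q :=
    measure_exists_mem_le (hcard N hNc) fun u hu =>
      (ha.measure_single_le (hNs hu) (gaussianVec_sum_excess_ge m (1 / 10 ^ 7) 80)).trans
        (weaken (by
          have := exp_neg_forty_le
          norm_num at this ⊢
          linarith))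
  have b4 : P {ω | ∃ u ∈ N', ω ∈ {ω | (1 / 2 + 1 / 100) * (m : ℝ) ≤
      ∑ i, (conj (phase (y ω x i)) * y ω u i).im ^ 2}} ≤ q :=
    measure_exists_mem_le (hcard N' hNc') fun u hu =>
      (ha.measure_im_le hx (hNs' hu).2 (hNs' hu).1).trans (weaken (by norm_num))
  have b5 : P {ω | 1 / 10 ^ 9 / 2 * (m : ℝ) ≤
      ∑ i, if ‖y ω x i‖ < 7 / 10 ^ 6 then (1 : ℝ) else 0} ≤ q :=
    (ha.measure_single_le hx
      (gaussianVec_card_small_ge m (τ := 7 / 10 ^ 6) (by norm_num) (1 / 10 ^ 9 / 2 * m))).trans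
      (ENNReal.ofReal_le_ofReal (Real.exp_le_exp.2 (by linarith)))
  have b6 : P {ω | ∑ i, (if ‖y ω x i‖ ^ 2 ≤ 8 then ‖y ω x i‖ ^ 4 else 0) ≤ 3 / 2 * (m : ℝ)} ≤ q :=
    (ha.measure_single_le hx (gaussianVec_sum_truncated_le m)).trans (weaken' (by norm_num))
  have b7 : P {ω | (1 + 1 / 10) * (m : ℝ) ≤ ∑ i, ‖y ω x i‖ ^ 2} ≤ q :=
    (ha.measure_single_le hx
      (gaussianVec_sum_norm_sq_ge m (c := 1 / 10) (by norm_num) (by norm_num))).trans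
      (weaken' (by norm_num))
  have b8 : P {ω | ∑ i, ‖y ω x i‖ ^ 2 ≤ (1 - 1 / 10) * (m : ℝ)} ≤ q :=
    (ha.measure_single_le hx
      (gaussianVec_sum_norm_sq_le m (c := 1 / 10) (by norm_num))).trans (weaken' (by norm_num))
  have b9 : P {ω | ∃ u ∈ N', ω ∈ {ω | ∑ i, ‖y ω x i‖ ^ 2 ≤ (1 + 1 / 10) * (m : ℝ) ∧
      23 / 20 * (m : ℝ) ≤ ∑ i, truncWeight (measurements (fun i => a i ω) x) i *
        ‖y ω u i‖ ^ 2}} ≤ q :=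
    measure_exists_mem_le (hcard N' hNc') fun u hu =>
      (ha.measure_weighted_le hm hx (hNs' hu).2 (hNs' hu).1).trans (weaken (by norm_num))
  have b10 : P {ω | ∃ u ∈ N', ω ∈ {ω | ∑ i, ‖y ω x i‖ ^ 2 ≤ (1 + 1 / 10) * (m : ℝ) ∧
      1 / 10 ^ 12 * (m : ℝ) ≤ ∑ i, ((truncWeight (measurements (fun i => a i ω) x) i : ℂ) *
        conj (y ω x i) * y ω u i).re}} ≤ q :=
    measure_exists_mem_le (hcard N' hNc') fun u hu =>
      (ha.measure_cross_le hm hx (hNs' hu).2 (hNs' hu).1).trans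
        (ENNReal.ofReal_le_ofReal (Real.exp_le_exp.2 (by linarith)))
  have hsum : ENNReal.ofReal (10 * Real.exp (-(1 / 10 ^ 27 * m)))
      = q + (q + (q + (q + (q + (q + (q + (q + (q + q)))))))) := by
    rw [ENNReal.ofReal_mul (by norm_num), ← hq, ENNReal.ofReal_ofNat]
    ring
  rw [hsum]
  refine le_trans (measure_mono ?_) ((measure_union_le _ _).trans (add_le_add b1
    ((measure_union_le _ _).trans (add_le_add b2 ((measure_union_le _ _).trans (add_le_add b3
    ((measure_union_le _ _).trans (add_le_add b4 ((measure_union_le _ _).trans (add_le_add b5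
    ((measure_union_le _ _).trans (add_le_add b6 ((measure_union_le _ _).trans (add_le_add b7
    ((measure_union_le _ _).trans (add_le_add b8 ((measure_union_le _ _).trans
      (add_le_add b9 b10))))))))))))))))))
  intro ω hω
  by_contra hnot
  simp only [Set.mem_union, Set.mem_ofPred_eq, not_or, not_exists, not_and, not_le] at hnot
  obtain ⟨h1, h2, h3, h4, h5, h6, h7, h8, h9, h10⟩ := hnot
  exact hω (GoodSensing.of_net hm hN (fun v hv hv1 => hN' v ⟨hv, hv1⟩) (fun u hu => (h1 u hu).le)
    (fun u hu => (h2 u hu).le) (fun u hu => (h3 u hu).le) (fun u hu => (h4 u hu).le) h5.le h6.le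
    h7.le h8.le (fun u hu => (h9 u hu h7.le).le) (fun u hu => (h10 u hu h7.le).le))

end Probability

/-! ### The zero signal and the conclusion. -/

theorem iInf_norm_sub_le_of_eq_zero {m n : ℕ} {a : Fin m → EuclideanSpace ℂ (Fin n)}
    {z : ℕ → EuclideanSpace ℂ (Fin n)} (hz : IsAltProjRun a (measurements a 0) z) {t : ℕ}
    (ht : 1 ≤ t) :
    ⨅ φ : ℝ, ‖Complex.exp ((φ : ℂ) * Complex.I) • (0 : EuclideanSpace ℂ (Fin n)) - z t‖ ≤ 0 := by
  obtain ⟨t, rfl⟩ := Nat.exists_eq_add_of_le' ht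
  have h0 : z (t + 1) = 0 := by
    rw [hz.step, altProjStep]
    have : (WithLp.toLp 2 fun i => (measurements a 0 i : ℂ) *
        phase (toEuclideanLin (measMatrix a) (z t) i)) = (0 : EuclideanSpace ℂ (Fin m)) := by
      ext i
      simp [measurements]
    rw [this, map_zero]
  simp [h0]

end PhaseRetrieval

theorem corollary1 :
    ∃ C₁ C₂ M δ : ℝ, 0 < C₁ ∧ 0 < C₂ ∧ 0 < M ∧ 0 < δ ∧ δ < 1 ∧
      ∀ (m n : ℕ), 0 < m → 0 < n → M * (n : ℝ) ≤ (m : ℝ) →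
      ∀ (x₀ : EuclideanSpace ℂ (Fin n))
        (Ω : Type*) [MeasurableSpace Ω] (P : Measure Ω) [IsProbabilityMeasure P]
        (a : Fin m → Ω → EuclideanSpace ℂ (Fin n)), PhaseRetrieval.IsGaussianSensing P a →
      ∃ E : Set Ω, MeasurableSet E ∧ 1 - C₁ * Real.exp (-C₂ * (m : ℝ)) ≤ P.real E ∧
        ∀ ω ∈ E, ∀ z : ℕ → EuclideanSpace ℂ (Fin n),
          PhaseRetrieval.IsAltProjRun (fun i => a i ω)
              (PhaseRetrieval.measurements (fun i => a i ω) x₀) z →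
            ∀ t : ℕ, 1 ≤ t →
              ⨅ φ : ℝ, ‖Complex.exp ((φ : ℂ) * Complex.I) • x₀ - z t‖ ≤ δ ^ t * ‖x₀‖ := by
  refine ⟨10, 1 / 10 ^ 27, 6 * 10 ^ 41, 9 / 10, by norm_num, by norm_num, by norm_num,
    by norm_num, by norm_num, ?_⟩
  intro m n hm hn hmn x₀ Ω _ P _ a ha
  by_cases hx0 : x₀ = 0
  · refine ⟨Set.univ, MeasurableSet.univ, ?_, fun ω _ z hz t ht => ?_⟩
    · rw [measureReal_def, measure_univ, ENNReal.toReal_one]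
      have := Real.exp_pos (-(1 / 10 ^ 27) * (m : ℝ))
      linarith
    · subst hx0
      rw [norm_zero, mul_zero]
      exact PhaseRetrieval.iInf_norm_sub_le_of_eq_zero hz ht
  · have hr : 0 < ‖x₀‖ := norm_pos_iff.2 hx0
    have hr' : (‖x₀‖ : ℂ) ≠ 0 := by exact_mod_cast hr.ne'
    obtain ⟨x, hx, hx₀⟩ : ∃ x : EuclideanSpace ℂ (Fin n), ‖x‖ = 1 ∧ x₀ = (‖x₀‖ : ℂ) • x := by
      refine ⟨(‖x₀‖ : ℂ)⁻¹ • x₀, ?_, by rw [smul_smul, mul_inv_cancel₀ hr', one_smul]⟩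
      rw [norm_smul, norm_inv, Complex.norm_real, norm_norm, inv_mul_cancel₀ hr.ne']
    set bad := {ω | ¬ PhaseRetrieval.GoodSensing (1 / 10 ^ 9) (7 / 10 ^ 6) (2 / 10 ^ 12)
      (fun i => a i ω) x} with hbad
    -- A measurable hull avoids proving that `bad`, defined by conditions on all vectors, is
    -- measurable.
    refine ⟨(toMeasurable P bad)ᶜ, (measurableSet_toMeasurable P bad).compl, ?_,
      fun ω hω z hz t ht => ?_⟩
    · rw [probReal_compl_eq_one_sub (measurableSet_toMeasurable P bad), neg_mul]
      have h1 : P.real (toMeasurable P bad) ≤ 10 * Real.exp (-(1 / 10 ^ 27 * (m : ℝ))) := by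
        rw [measureReal_def, measure_toMeasurable]
        exact ENNReal.toReal_le_of_le_ofReal (by positivity)
          (ha.measure_not_goodSensing_le hm hmn hx)
      linarith
    · have hgood : PhaseRetrieval.GoodSensing (1 / 10 ^ 9) (7 / 10 ^ 6) (2 / 10 ^ 12)
          (fun i => a i ω) x := by
        by_contra h
        exact hω (subset_toMeasurable P bad h)
      rw [hx₀] at hz ⊢
      -- The radius `γ` must exceed `10 / 3 * κ ≈ 6.7 / 10 ^ 12`, so that the initialization falls
      -- in the basin, and stay below `√(β * τ ^ 2 / 800) ≈ 7.8 / 10 ^ 12`.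
      exact hgood.iInf_norm_sub_le (γ := 7 / 10 ^ 12) hm hx (by norm_num) (by norm_num)
        (by norm_num) (by norm_num) (by norm_num) hr hz ht
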